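/- Let $(A,\Delta)$ be an algebraic quantum group over $\mathbb C$: $A$ is an associative, possibly non-unital algebra with non-degenerate product, $\Delta:A\to M(A\otimes A)$ is a coassociative homomorphism into the multiplier algebra such that the four maps $a\otimes a'\mapsto \Delta(a)(1\otimes a')$, $(a\otimes 1)\Delta(a')$, $\Delta(a)(a'\otimes 1)$, $(1\otimes a)\Delta(a')$ are bijections of $A\otimes A$ (a regular multiplier Hopf algebra), and there is a non-zero left invariant functional $\varphi$ on $A$, i.e. $(\iota\otimes\varphi)\Delta(a)=\varphi(a)1$ for all $a$. Fix $\varphi$, let $S$ be the antipode of $A$ and $\psi=\varphi\circ S$. Let $B=\widehat A=\{\varphi(\,\cdot\,c): c\in A\}$ be the dual, with pairing $\langle a,b\rangle=b(a)$, product given by $\langle a,bb'\rangle=\langle\Delta(a),b\otimes b'\rangle$, and antipode $S$ given by $\langle a,S(b)\rangle=\langle S(a),b\rangle$. Pair $B\otimes A$ with $A\otimes B$ by $\langle b\otimes a,a'\otimes b'\rangle=\langle a',b\rangle\langle a,b'\rangle$, and extend this to $M(B\otimes A)\times(A\otimes B)$ by $\langle m,x\triangleright y\rangle=\langle mx,y\rangle$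 and $\langle m,y\triangleleft x\rangle=\langle xm,y\rangle$, where $x\triangleright y$, $y\triangleleft x$ are the elements of $A\otimes B$ with $\langle x',x\triangleright y\rangle=\langle x'x,y\rangle$ and $\langle x',y\triangleleft x\rangle=\langle xx',y\rangle$ for all $x'\in B\otimes A$. Then the antipodes of $A$ and of $B$ exist and are bijective, $\psi$ is a right integral (non-zero, $(\psi\otimes\iota)\Delta(a)=\psi(a)1$), and $B=\{\varphi(c\,\cdot\,):c\in A\}=\{\psi(\,\cdot\,c):c\in A\}$. There is a unique $V\in M(B\otimes A)$ with $\langle V,a\otimes b\rangle=\langle a,b\rangle$ for all $a\in A$, $b\in B$. As a left and as a right multiplier it is given by $$V(b\otimes a)=\sum_{(c)}\varphi(c_{(2)}\,\cdot\,)\otimes S(c_{(1)})a\quad\text{if } b=\varphi(c\,\cdot\,),\qquad (b\otimes a)V=\sum_{(c)}\psi(\,\cdot\,c_{(1)})\otimes aS(c_{(2)})\quad\text{if } b=\psi(\,\cdot\,c).$$ Moreover $(1\otimes a)V(b\otimes 1)$ and $(b\otimes 1)V(1\otimes a)$ lie in $B\otimes A$ for all $a\in A$, $b\in B$, and $(\iota\otimes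 S)V$ and $(S\otimes\iota)V$ are in $M(B\otimes A)$: there are unique $W,W'\in M(B\otimes A)$ such that for all $a\in A$, $b\in B$ $$W(b\otimes S(a))=(\iota\otimes S)\big((1\otimes a)V(b\otimes1)\big),\qquad (b\otimes S(a))W=(\iota\otimes S)\big((b\otimes 1)V(1\otimes a)\big),$$ $$W'(S(b)\otimes a)=(S\otimes\iota)\big((b\otimes1)V(1\otimes a)\big),\qquad (S(b)\otimes a)W'=(S\otimes\iota)\big((1\otimes a)V(b\otimes1)\big),$$ and these satisfy $\langle W,a\otimes b\rangle=\langle a,S(b)\rangle$ and $\langle W',a\otimes b\rangle=\langle S(a),b\rangle$. -/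

import Mathlib

open scoped TensorProduct

noncomputable section

/-! ### Multiplier algebras and slices -/

/-- The product of `C` is non-degenerate. -/
def NondegenerateProduct (C : Type*) [NonUnitalRing C] : Prop :=
  (∀ a : C, (∀ b, a * b = 0) → a = 0) ∧ (∀ a : C, (∀ b, b * a = 0) → a = 0)

section Multiplier

variable (C : Type*) [NonUnitalRing C] [Module ℂ C] [IsScalarTower ℂ C C] [SMulCommClass ℂ C C]

/-- The multiplier algebra `M(C)`: pairs `m = (L, R)` of linear maps, `L x = m x` and `R x = x m`,
with `L (x y) = (L x) y`, `R (x y) = x (R y)` and `(R x) y = x (L y)`. The second component lives in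
the opposite algebra, so that `x (m m') = (x m) m'`. -/
def MultiplierAlgebra :
    Subalgebra ℂ (Module.End ℂ C × (Module.End ℂ C)ᵐᵒᵖ) where
  carrier := {p | (∀ x y, p.1 (x * y) = p.1 x * y) ∧
    (∀ x y, p.2.unop (x * y) = x * p.2.unop y) ∧ (∀ x y, p.2.unop x * y = x * p.1 y)}
  mul_mem' := by
    rintro p q ⟨h1, h2, h3⟩ ⟨k1, k2, k3⟩
    refine ⟨fun x y => ?_, fun x y => ?_, fun x y => ?_⟩ <;> simp_all
  add_mem' := by
    rintro p q ⟨h1, h2, h3⟩ ⟨k1, k2, k3⟩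
    refine ⟨fun x y => ?_, fun x y => ?_, fun x y => ?_⟩ <;> simp_all [mul_add, add_mul]
  algebraMap_mem' := by
    intro r
    refine ⟨fun x y => ?_, fun x y => ?_, fun x y => ?_⟩ <;>
      simp [MulOpposite.algebraMap_apply, Module.algebraMap_end_apply, mul_smul_comm,
        smul_mul_assoc]

variable {C}

/-- `m.left x` is the product `m x`. -/
def MultiplierAlgebra.left (m : MultiplierAlgebra C) : C →ₗ[ℂ] C := m.1.1

/-- `m.right x` is the product `x m`. -/
def MultiplierAlgebra.right (m : MultiplierAlgebra C) : C →ₗ[ℂ] C := m.1.2.unop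

namespace MultiplierAlgebra

@[ext] theorem ext' {m n : MultiplierAlgebra C} (h1 : ∀ x, left m x = left n x)
    (h2 : ∀ x, right m x = right n x) : m = n :=
  Subtype.ext (Prod.ext (LinearMap.ext h1) (MulOpposite.unop_injective (LinearMap.ext h2)))

theorem left_mul (m : MultiplierAlgebra C) (x y : C) : left m (x * y) = left m x * y :=
  m.2.1 x y

theorem right_mul (m : MultiplierAlgebra C) (x y : C) : right m (x * y) = x * right m y :=
  m.2.2.1 x y

theorem right_mul_eq (m : MultiplierAlgebra C) (x y : C) : right m x * y = x * left m y :=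
  m.2.2.2 x y

theorem left_mul_apply (m n : MultiplierAlgebra C) (x : C) :
    left (m * n) x = left m (left n x) := rfl

theorem right_mul_apply (m n : MultiplierAlgebra C) (x : C) :
    right (m * n) x = right n (right m x) := rfl

/-- The canonical map `C → M(C)`. -/
def embed : C →ₗ[ℂ] MultiplierAlgebra C where
  toFun c := ⟨(LinearMap.mulLeft ℂ c, MulOpposite.op (LinearMap.mulRight ℂ c)),
    fun x y => by simp [mul_assoc], fun x y => by simp [mul_assoc],
    fun x y => by simp [mul_assoc]⟩
  map_add' x y := by ext z <;> simp [left, right, add_mul, mul_add]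
  map_smul' r x := by ext z <;> simp [left, right, smul_mul_assoc, mul_smul_comm]

@[simp] theorem left_embed (c x : C) : left (embed c) x = c * x := rfl

@[simp] theorem right_embed (c x : C) : right (embed c) x = x * c := rfl

theorem mul_embed (m : MultiplierAlgebra C) (x : C) : m * embed x = embed (left m x) := by
  ext y
  · simp [left_mul_apply, left_mul]
  · simp [right_mul_apply, right_mul_eq]

theorem embed_injective (h : NondegenerateProduct C) :
    Function.Injective (embed : C → MultiplierAlgebra C) := by
  intro x y hxy
  rw [← sub_eq_zero]
  refine h.1 _ fun z => ?_
  have : left (embed x) z = left (embed y) z := by rw [hxy]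
  simpa [sub_mul, sub_eq_zero] using this

section Tensor

variable {D : Type*} [NonUnitalRing D] [Module ℂ D] [IsScalarTower ℂ D D] [SMulCommClass ℂ D D]

/-- The multiplier `c ⊗ 1` of `C ⊗ D`. -/
def inl (c : C) : MultiplierAlgebra (C ⊗[ℂ] D) :=
  ⟨((LinearMap.mulLeft ℂ c).rTensor D, MulOpposite.op ((LinearMap.mulRight ℂ c).rTensor D)), by
    refine ⟨fun x y => ?_, fun x y => ?_, fun x y => ?_⟩ <;>
    induction x with
    | zero => simp
    | add x x' hx hx' => simp_all [add_mul]
    | tmul p q =>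
      induction y with
      | zero => simp
      | add y y' hy hy' => simp_all [mul_add]
      | tmul r s => simp [mul_assoc]⟩

/-- The multiplier `1 ⊗ d` of `C ⊗ D`. -/
def inr (d : D) : MultiplierAlgebra (C ⊗[ℂ] D) :=
  ⟨((LinearMap.mulLeft ℂ d).lTensor C, MulOpposite.op ((LinearMap.mulRight ℂ d).lTensor C)), by
    refine ⟨fun x y => ?_, fun x y => ?_, fun x y => ?_⟩ <;>
    induction x with
    | zero => simp
    | add x x' hx hx' => simp_all [add_mul]
    | tmul p q =>
      induction y with
      | zero => simp
      | add y y' hy hy' => simp_all [mul_add]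
      | tmul r s => simp [mul_assoc]⟩

theorem left_inl (c : C) : left (inl (D := D) c) = (LinearMap.mulLeft ℂ c).rTensor D := rfl
theorem right_inl (c : C) : right (inl (D := D) c) = (LinearMap.mulRight ℂ c).rTensor D := rfl
theorem left_inr (d : D) : left (inr (C := C) d) = (LinearMap.mulLeft ℂ d).lTensor C := rfl
theorem right_inr (d : D) : right (inr (C := C) d) = (LinearMap.mulRight ℂ d).lTensor C := rfl

theorem embed_mul (m : MultiplierAlgebra C) (x : C) : embed x * m = embed (right m x) := by
  ext y
  · simp [left_mul_apply, right_mul_eq]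
  · simp [right_mul_apply, right_mul]

theorem inr_mul_inl (c : C) (d : D) : inr d * inl c = embed (c ⊗ₜ[ℂ] d) := by
  ext y <;> induction y with
  | zero => simp
  | add y y' hy hy' => simp_all [mul_add, add_mul]
  | tmul r s =>
    simp [left_mul_apply, right_mul_apply, left_inl, left_inr, right_inl, right_inr]

end Tensor

end MultiplierAlgebra

end Multiplier

section Slice

variable {V W : Type*} [AddCommGroup V] [Module ℂ V] [AddCommGroup W] [Module ℂ W]

/-- The slice map `ι ⊗ ω : V ⊗ W → V`. -/
def sliceRight (ω : W →ₗ[ℂ] ℂ) : V ⊗[ℂ] W →ₗ[ℂ] V :=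
  (TensorProduct.rid ℂ V).toLinearMap ∘ₗ ω.lTensor V

/-- The slice map `ω ⊗ ι : V ⊗ W → W`. -/
def sliceLeft (ω : V →ₗ[ℂ] ℂ) : V ⊗[ℂ] W →ₗ[ℂ] W :=
  (TensorProduct.lid ℂ W).toLinearMap ∘ₗ ω.rTensor W

@[simp] theorem sliceRight_tmul (ω : W →ₗ[ℂ] ℂ) (v : V) (w : W) :
    sliceRight ω (v ⊗ₜ[ℂ] w) = ω w • v := by simp [sliceRight]

@[simp] theorem sliceLeft_tmul (ω : V →ₗ[ℂ] ℂ) (v : V) (w : W) :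
    sliceLeft ω (v ⊗ₜ[ℂ] w) = ω v • w := by simp [sliceLeft]

theorem eq_zero_of_sliceRight (z : V ⊗[ℂ] W)
    (h : ∀ ω : W →ₗ[ℂ] ℂ, sliceRight ω z = 0) : z = 0 := by
  classical
  let b := Module.Basis.ofVectorSpace ℂ W
  apply (TensorProduct.equivFinsuppOfBasisRight (M := V) b).injective
  ext i
  rw [map_zero, Finsupp.zero_apply, ← h (b.coord i)]
  clear h
  induction z with
  | zero => simp
  | add x y hx hy => simp_all
  | tmul v w => simp [smul_mul_assoc, mul_smul_comm]

theorem eq_zero_of_sliceLeft (z : V ⊗[ℂ] W)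
    (h : ∀ ω : V →ₗ[ℂ] ℂ, sliceLeft ω z = 0) : z = 0 := by
  apply (TensorProduct.comm ℂ V W).injective
  rw [map_zero]
  refine eq_zero_of_sliceRight _ fun ω => ?_
  rw [← h ω]
  clear h
  induction z with
  | zero => simp
  | add x y hx hy => simp_all
  | tmul v w => simp [smul_mul_assoc, mul_smul_comm]

end Slice

/-- The tensor product of non-degenerate algebras is non-degenerate. -/
theorem NondegenerateProduct.tensor {C D : Type*}
    [NonUnitalRing C] [Module ℂ C] [IsScalarTower ℂ C C] [SMulCommClass ℂ C C]
    [NonUnitalRing D] [Module ℂ D] [IsScalarTower ℂ D D] [SMulCommClass ℂ D D]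
    (hC : NondegenerateProduct C) (hD : NondegenerateProduct D) :
    NondegenerateProduct (C ⊗[ℂ] D) := by
  constructor
  · intro z hz
    refine eq_zero_of_sliceLeft z fun ω => hD.1 _ fun d => ?_
    have h1 : (LinearMap.mulRight ℂ d).lTensor C z = 0 := by
      refine eq_zero_of_sliceRight _ fun θ => hC.1 _ fun c => ?_
      have h2 : sliceRight θ ((LinearMap.mulRight ℂ d).lTensor C z) * c
          = sliceRight θ (z * (c ⊗ₜ[ℂ] d)) := by
        clear hz
        induction z with
        | zero => simp
        | add x y hx hy => simp_all [add_mul]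
        | tmul v w => simp [smul_mul_assoc, mul_smul_comm]
      rw [h2, hz, map_zero]
    have h3 : sliceLeft ω z * d = sliceLeft ω ((LinearMap.mulRight ℂ d).lTensor C z) := by
      clear hz h1
      induction z with
      | zero => simp
      | add x y hx hy => simp_all [add_mul]
      | tmul v w => simp [smul_mul_assoc, mul_smul_comm]
    rw [h3, h1, map_zero]
  · intro z hz
    refine eq_zero_of_sliceLeft z fun ω => hD.2 _ fun d => ?_
    have h1 : (LinearMap.mulLeft ℂ d).lTensor C z = 0 := by
      refine eq_zero_of_sliceRight _ fun θ => hC.2 _ fun c => ?_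
      have h2 : c * sliceRight θ ((LinearMap.mulLeft ℂ d).lTensor C z)
          = sliceRight θ ((c ⊗ₜ[ℂ] d) * z) := by
        clear hz
        induction z with
        | zero => simp
        | add x y hx hy => simp_all [mul_add]
        | tmul v w => simp [smul_mul_assoc, mul_smul_comm]
      rw [h2, hz, map_zero]
    have h3 : d * sliceLeft ω z = sliceLeft ω ((LinearMap.mulLeft ℂ d).lTensor C z) := by
      clear hz h1
      induction z with
      | zero => simp
      | add x y hx hy => simp_all [mul_add]
      | tmul v w => simp [smul_mul_assoc, mul_smul_comm]
    rw [h3, h1, map_zero]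

/-! ### Regular multiplier Hopf algebras and algebraic quantum groups -/

open MultiplierAlgebra

/-- Coassociativity, covered from both sides:
`(a ⊗ 1 ⊗ 1)(Δ ⊗ ι)(Δ(b)(1 ⊗ c)) = (ι ⊗ Δ)((a ⊗ 1)Δ(b))(1 ⊗ 1 ⊗ c)`,
where `T (a ⊗ b) = Δ(a)(1 ⊗ b)` and `T' (a ⊗ b) = (a ⊗ 1)Δ(b)`. -/
def Coassociative {A : Type*} [AddCommGroup A] [Module ℂ A]
    (T T' : A ⊗[ℂ] A →ₗ[ℂ] A ⊗[ℂ] A) : Prop :=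
  ∀ a b c : A,
    TensorProduct.assoc ℂ A A A
        (T'.rTensor A ((TensorProduct.assoc ℂ A A A).symm (a ⊗ₜ[ℂ] T (b ⊗ₜ[ℂ] c))))
      = T.lTensor A (TensorProduct.assoc ℂ A A A (T' (a ⊗ₜ[ℂ] b) ⊗ₜ[ℂ] c))

/-- A regular multiplier Hopf algebra over `ℂ`: a non-degenerate algebra `A` with a homomorphism
`Δ : A → M(A ⊗ A)` such that both `Δ` and the flipped coproduct `Δ^cop` are coassociative and have
canonical maps that are bijections of `A ⊗ A`. The four canonical maps are determined by `Δ`. -/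
structure RegularMultiplierHopfAlgebra (A : Type*) [NonUnitalRing A] [Module ℂ A]
    [IsScalarTower ℂ A A] [SMulCommClass ℂ A A] where
  nondegenerate : NondegenerateProduct A
  comul : A →ₙₐ[ℂ] MultiplierAlgebra (A ⊗[ℂ] A)
  /-- `a ⊗ b ↦ Δ(a)(1 ⊗ b)` -/
  T₁ : A ⊗[ℂ] A ≃ₗ[ℂ] A ⊗[ℂ] A
  /-- `a ⊗ b ↦ (a ⊗ 1)Δ(b)` -/
  T₂ : A ⊗[ℂ] A ≃ₗ[ℂ] A ⊗[ℂ] A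
  /-- `a ⊗ b ↦ Δ(a)(b ⊗ 1)` -/
  T₃ : A ⊗[ℂ] A ≃ₗ[ℂ] A ⊗[ℂ] A
  /-- `a ⊗ b ↦ (1 ⊗ a)Δ(b)` -/
  T₄ : A ⊗[ℂ] A ≃ₗ[ℂ] A ⊗[ℂ] A
  embed_T₁ : ∀ a b, embed (T₁ (a ⊗ₜ b)) = comul a * inr b
  embed_T₂ : ∀ a b, embed (T₂ (a ⊗ₜ b)) = inl a * comul b
  embed_T₃ : ∀ a b, embed (T₃ (a ⊗ₜ b)) = comul a * inl b
  embed_T₄ : ∀ a b, embed (T₄ (a ⊗ₜ b)) = inr a * comul b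
  coassoc : Coassociative T₁.toLinearMap T₂.toLinearMap
  coassoc_cop : Coassociative
    ((TensorProduct.comm ℂ A A).toLinearMap ∘ₗ T₃.toLinearMap)
    ((TensorProduct.comm ℂ A A).toLinearMap ∘ₗ T₄.toLinearMap)

namespace RegularMultiplierHopfAlgebra

variable {A : Type*} [NonUnitalRing A] [Module ℂ A] [IsScalarTower ℂ A A] [SMulCommClass ℂ A A]

/-- `ε` is the counit:
`(ε ⊗ ι)(Δ(a)(1 ⊗ b)) = ab` and `(ι ⊗ ε)((a ⊗ 1)Δ(b)) = ab`. -/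
def IsCounit (H : RegularMultiplierHopfAlgebra A) (ε : A →ₗ[ℂ] ℂ) : Prop :=
  (∀ a b, sliceLeft ε (H.T₁ (a ⊗ₜ b)) = a * b) ∧ (∀ a b, sliceRight ε (H.T₂ (a ⊗ₜ b)) = a * b)

/-- `S` is the antipode: with `ε` the counit and `m` the product map,
`m(S ⊗ ι)(Δ(a)(1 ⊗ b)) = ε(a)b` and `m(ι ⊗ S)((a ⊗ 1)Δ(b)) = ε(b)a`. -/
def IsAntipode (H : RegularMultiplierHopfAlgebra A) (S : A ≃ₗ[ℂ] A) : Prop :=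
  ∃ ε, H.IsCounit ε ∧
    (∀ a b, LinearMap.mul' ℂ A (S.toLinearMap.rTensor A (H.T₁ (a ⊗ₜ b))) = ε a • b) ∧
    (∀ a b, LinearMap.mul' ℂ A (S.toLinearMap.lTensor A (H.T₂ (a ⊗ₜ b))) = ε b • a)

/-- The antipode of `A`. -/
def antipode (H : RegularMultiplierHopfAlgebra A) : A ≃ₗ[ℂ] A :=
  Classical.epsilon H.IsAntipode

/-- A left integral: a non-zero functional with `(ι ⊗ φ)Δ(a) = φ(a)1` in `M(A)`, both as a left and
as a right multiplier. -/
def IsLeftIntegral (H : RegularMultiplierHopfAlgebra A) (φ : A →ₗ[ℂ] ℂ) : Prop :=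
  φ ≠ 0 ∧ (∀ a b, sliceRight φ (H.T₃ (a ⊗ₜ b)) = φ a • b) ∧
    (∀ a b, sliceRight φ (H.T₂ (b ⊗ₜ a)) = φ a • b)

/-- A right integral: a non-zero functional with `(ψ ⊗ ι)Δ(a) = ψ(a)1` in `M(A)`, both as a left and
as a right multiplier. -/
def IsRightIntegral (H : RegularMultiplierHopfAlgebra A) (ψ : A →ₗ[ℂ] ℂ) : Prop :=
  ψ ≠ 0 ∧ (∀ a b, sliceLeft ψ (H.T₁ (a ⊗ₜ b)) = ψ a • b) ∧
    (∀ a b, sliceLeft ψ (H.T₄ (b ⊗ₜ a)) = ψ a • b)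

end RegularMultiplierHopfAlgebra

/-- An algebraic quantum group, with a fixed left integral `φ`. -/
structure AlgebraicQuantumGroup (A : Type*) [NonUnitalRing A] [Module ℂ A]
    [IsScalarTower ℂ A A] [SMulCommClass ℂ A A] extends RegularMultiplierHopfAlgebra A where
  φ : A →ₗ[ℂ] ℂ
  isLeftIntegral_φ : toRegularMultiplierHopfAlgebra.IsLeftIntegral φ

namespace AlgebraicQuantumGroup

variable {A : Type*} [NonUnitalRing A] [Module ℂ A] [IsScalarTower ℂ A A] [SMulCommClass ℂ A A]

/-- The antipode `S` of `A`. -/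
def S (G : AlgebraicQuantumGroup A) : A ≃ₗ[ℂ] A := G.toRegularMultiplierHopfAlgebra.antipode

/-- The right integral `ψ = φ ∘ S`. -/
def ψ (G : AlgebraicQuantumGroup A) : A →ₗ[ℂ] ℂ := G.φ ∘ₗ G.S.toLinearMap

/-- `c ↦ f(· c)` -/
def mulRightFunctional (f : A →ₗ[ℂ] ℂ) : A →ₗ[ℂ] (A →ₗ[ℂ] ℂ) :=
  ((LinearMap.mul ℂ A).compr₂ f).flip

/-- `c ↦ f(c ·)` -/
def mulLeftFunctional (f : A →ₗ[ℂ] ℂ) : A →ₗ[ℂ] (A →ₗ[ℂ] ℂ) :=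
  (LinearMap.mul ℂ A).compr₂ f

@[simp] theorem mulRightFunctional_apply (f : A →ₗ[ℂ] ℂ) (c x : A) :
    mulRightFunctional f c x = f (x * c) := rfl

@[simp] theorem mulLeftFunctional_apply (f : A →ₗ[ℂ] ℂ) (c x : A) :
    mulLeftFunctional f c x = f (c * x) := rfl

/-- The underlying space of the dual: the functionals `φ(· c)` with `c ∈ A`. -/
def dualSubmodule (G : AlgebraicQuantumGroup A) : Submodule ℂ (A →ₗ[ℂ] ℂ) :=
  LinearMap.range (mulRightFunctional G.φ)

/-- The dual `B = Â`; its product is defined below. -/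
def Dual (G : AlgebraicQuantumGroup A) : Type _ := G.dualSubmodule

variable (G : AlgebraicQuantumGroup A)

instance : AddCommGroup G.Dual := inferInstanceAs (AddCommGroup G.dualSubmodule)

instance : Module ℂ G.Dual := inferInstanceAs (Module ℂ G.dualSubmodule)

/-- The inclusion of `B` in the space of functionals on `A`. -/
def toFunctional : G.Dual →ₗ[ℂ] (A →ₗ[ℂ] ℂ) := G.dualSubmodule.subtype

/-- The canonical pairing `⟨a, b⟩` of `A` with `B`: evaluation of `b` in `a`. -/
def pair (a : A) (b : G.Dual) : ℂ := G.toFunctional b a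

theorem toFunctional_injective : Function.Injective G.toFunctional :=
  Subtype.val_injective

theorem exists_repr (b : G.Dual) : ∃ c, mulRightFunctional G.φ c = G.toFunctional b := b.2

/-- The left action `b ▷ a = (ι ⊗ b)Δ(a)`, that is `(ι ⊗ φ)(Δ(a)(1 ⊗ c))` for `b = φ(· c)`. -/
def act (b : G.Dual) : A →ₗ[ℂ] A :=
  sliceRight G.φ ∘ₗ G.T₁.toLinearMap ∘ₗ
    (TensorProduct.mk ℂ A A).flip (G.exists_repr b).choose

/-- The action does not depend on the choice of `c`. -/
theorem mul_act (b : G.Dual) (x a : A) :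
    x * G.act b a = sliceRight (G.toFunctional b) (G.T₂ (x ⊗ₜ a)) := by
  rw [← (G.exists_repr b).choose_spec]
  change x * sliceRight G.φ (G.T₁ (a ⊗ₜ[ℂ] (G.exists_repr b).choose)) = _
  generalize (G.exists_repr b).choose = c
  have h1 : (LinearMap.mulLeft ℂ x).rTensor A (G.T₁ (a ⊗ₜ[ℂ] c))
      = (LinearMap.mulRight ℂ c).lTensor A (G.T₂ (x ⊗ₜ[ℂ] a)) := by
    apply embed_injective (G.nondegenerate.tensor G.nondegenerate)
    rw [← left_inl, ← right_inr, ← mul_embed, ← embed_mul, G.embed_T₁, G.embed_T₂, mul_assoc]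
  have h2 : ∀ z : A ⊗[ℂ] A, x * sliceRight G.φ z
      = sliceRight G.φ ((LinearMap.mulLeft ℂ x).rTensor A z) := by
    intro z
    induction z with
    | zero => simp
    | add x y hx hy => simp_all [mul_add]
    | tmul v w => simp [smul_mul_assoc, mul_smul_comm]
  have h3 : ∀ z : A ⊗[ℂ] A, sliceRight (mulRightFunctional G.φ c) z
      = sliceRight G.φ ((LinearMap.mulRight ℂ c).lTensor A z) := by
    intro z
    induction z with
    | zero => simp
    | add x y hx hy => simp_all
    | tmul v w => simp [smul_mul_assoc, mul_smul_comm]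
  rw [h2, h1, h3]

theorem eq_of_mul_left (G : AlgebraicQuantumGroup A) {x y : A} (h : ∀ z, z * x = z * y) : x = y := by
  rw [← sub_eq_zero]
  exact G.nondegenerate.2 _ fun z => by rw [mul_sub, h, sub_self]

/-- The functional `a ↦ ⟨Δ(a), b ⊗ b'⟩ = ⟨b' ▷ a, b⟩` lies in the dual. -/
theorem mul_mem (b b' : G.Dual) : G.toFunctional b ∘ₗ G.act b' ∈ G.dualSubmodule := by
  obtain ⟨c, hc⟩ := G.exists_repr b
  set c' := (G.exists_repr b').choose with hc'
  refine ⟨sliceRight G.φ (G.T₃.symm (c ⊗ₜ[ℂ] c')), LinearMap.ext fun a => ?_⟩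
  rw [← hc]
  change G.φ (a * sliceRight G.φ (G.T₃.symm (c ⊗ₜ[ℂ] c')))
    = G.φ (sliceRight G.φ (G.T₁ (a ⊗ₜ[ℂ] c')) * c)
  have h1 : (LinearMap.mulRight ℂ c).rTensor A (G.T₁ (a ⊗ₜ[ℂ] c'))
      = left (G.comul a) (c ⊗ₜ[ℂ] c') := by
    apply embed_injective (G.nondegenerate.tensor G.nondegenerate)
    rw [← right_inl, ← embed_mul, ← mul_embed, G.embed_T₁, mul_assoc, inr_mul_inl]
  have h2 : ∀ z : A ⊗[ℂ] A, sliceRight G.φ z * c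
      = sliceRight G.φ ((LinearMap.mulRight ℂ c).rTensor A z) := by
    intro z
    induction z with
    | zero => simp
    | add x y hx hy => simp_all [add_mul]
    | tmul v w => simp [smul_mul_assoc, mul_smul_comm]
  have h3 : ∀ z : A ⊗[ℂ] A, left (G.comul a) (G.T₃ z)
      = G.T₃ ((LinearMap.mulLeft ℂ a).rTensor A z) := by
    intro z
    induction z with
    | zero => simp
    | add x y hx hy => simp_all
    | tmul v w =>
      apply embed_injective (G.nondegenerate.tensor G.nondegenerate)
      rw [← mul_embed, LinearMap.rTensor_tmul, G.embed_T₃, G.embed_T₃, LinearMap.mulLeft_apply,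
        map_mul, mul_assoc]
  rw [h2, h1]
  obtain ⟨z, hz⟩ : ∃ z, G.T₃ z = c ⊗ₜ[ℂ] c' := G.T₃.surjective _
  rw [← hz, h3, LinearEquiv.symm_apply_apply]
  clear hz
  induction z with
  | zero => simp
  | add x y hx hy => simp_all [mul_add]
  | tmul v w =>
    rw [LinearMap.rTensor_tmul, G.isLeftIntegral_φ.2.1]
    simp [mul_smul_comm, mul_comm]

/-- The product of `B`: `⟨a, b b'⟩ = ⟨Δ(a), b ⊗ b'⟩ = ⟨b' ▷ a, b⟩`. -/
instance : Mul G.Dual := ⟨fun b b' => ⟨G.toFunctional b ∘ₗ G.act b', G.mul_mem b b'⟩⟩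

theorem toFunctional_mul (b b' : G.Dual) (a : A) :
    G.toFunctional (b * b') a = G.toFunctional b (G.act b' a) := rfl

theorem act_mul (b b' : G.Dual) (a : A) : G.act (b * b') a = G.act b (G.act b' a) := by
  have h1 : ∀ z : A ⊗[ℂ] A, sliceRight (G.toFunctional (b * b')) z
      = sliceRight (G.toFunctional b) ((G.act b').lTensor A z) := by
    intro z
    induction z with
    | zero => simp
    | add x y hx hy => simp_all
    | tmul v w => simp [toFunctional_mul]
  refine G.eq_of_mul_left fun x => ?_
  rw [mul_act, mul_act, h1]
  congr 1
  set c := (G.exists_repr b').choose with hc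
  have hact : ∀ q, G.act b' q = sliceRight G.φ (G.T₁ (q ⊗ₜ[ℂ] c)) := fun q => rfl
  have h2 : ∀ z : A ⊗[ℂ] A, (G.act b').lTensor A z
      = (sliceRight G.φ).lTensor A (G.T₁.toLinearMap.lTensor A
          (TensorProduct.assoc ℂ A A A (z ⊗ₜ[ℂ] c))) := by
    intro z
    induction z with
    | zero => simp
    | add x y hx hy => simp_all [TensorProduct.add_tmul]
    | tmul v w => simp [hact]
  have h3 : ∀ z : A ⊗[ℂ] A, (sliceRight G.φ).lTensor A (TensorProduct.assoc ℂ A A A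
        (G.T₂.toLinearMap.rTensor A ((TensorProduct.assoc ℂ A A A).symm (x ⊗ₜ[ℂ] z))))
      = G.T₂ (x ⊗ₜ[ℂ] sliceRight G.φ z) := by
    intro z
    induction z with
    | zero => simp
    | add x y hx hy => simp_all [TensorProduct.tmul_add]
    | tmul v w =>
      have h4 : ∀ y : A ⊗[ℂ] A, (sliceRight G.φ).lTensor A
          (TensorProduct.assoc ℂ A A A (y ⊗ₜ[ℂ] w)) = G.φ w • y := by
        intro y
        induction y with
        | zero => simp
        | add x y hx hy => simp_all [TensorProduct.add_tmul]
        | tmul p q => simp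
      simp [h4]
  rw [h2, hact, ← h3]
  exact congrArg _ (G.coassoc x a c).symm

theorem act_add (b b' : G.Dual) (a : A) : G.act (b + b') a = G.act b a + G.act b' a := by
  refine G.eq_of_mul_left fun x => ?_
  rw [mul_add, mul_act, mul_act, mul_act]
  simp [sliceRight, LinearMap.lTensor_add]

theorem act_smul (r : ℂ) (b : G.Dual) (a : A) : G.act (r • b) a = r • G.act b a := by
  refine G.eq_of_mul_left fun x => ?_
  rw [mul_smul_comm, mul_act, mul_act]
  simp [sliceRight, LinearMap.lTensor_smul]

theorem dual_ext {b b' : G.Dual} (h : ∀ a, G.toFunctional b a = G.toFunctional b' a) :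
    b = b' := G.toFunctional_injective (LinearMap.ext h)

instance : NonUnitalRing G.Dual where
  left_distrib x y z := G.dual_ext fun a => by simp [toFunctional_mul, act_add]
  right_distrib x y z := G.dual_ext fun a => by simp [toFunctional_mul]
  zero_mul x := G.dual_ext fun a => by simp [toFunctional_mul]
  mul_zero x := G.dual_ext fun a => by
    have h : G.act 0 a = 0 := by simpa using G.act_add 0 0 a
    simp [toFunctional_mul, h]
  mul_assoc x y z := G.dual_ext fun a => by simp [toFunctional_mul, act_mul]

instance : IsScalarTower ℂ G.Dual G.Dual where
  smul_assoc r x y := G.dual_ext fun a => by simp [toFunctional_mul, smul_eq_mul]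

instance : SMulCommClass ℂ G.Dual G.Dual where
  smul_comm r x y := G.dual_ext fun a => by simp [toFunctional_mul, act_smul, smul_eq_mul]

/-- `S` is the antipode of the dual, the transpose of the antipode of `A`:
`⟨a, S(b)⟩ = ⟨S(a), b⟩`. -/
def IsDualAntipode (S' : G.Dual ≃ₗ[ℂ] G.Dual) : Prop :=
  ∀ a b, G.pair a (S' b) = G.pair (G.S a) b

/-- The antipode of the dual `B`. -/
def dualS : G.Dual ≃ₗ[ℂ] G.Dual := Classical.epsilon G.IsDualAntipode

end AlgebraicQuantumGroup

/-! ### Extended pairings and the duality -/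

/-- Let `p` be a pairing of an algebra `C` with a space `D`. The functional `f` on `D` is the extended
pairing `⟨m, ·⟩` with the multiplier `m ∈ M(C)`: `⟨m, x ▷ y⟩ = ⟨mx, y⟩` and `⟨m, y ◁ x⟩ = ⟨xm, y⟩`.
Here `x ▷ y` and `y ◁ x` are the elements of `D` with
`⟨x', x ▷ y⟩ = ⟨x'x, y⟩` and `⟨x', y ◁ x⟩ = ⟨xx', y⟩` for all `x'`. -/
def IsExtendedPairing {C D : Type*} [NonUnitalRing C] [Module ℂ C] [IsScalarTower ℂ C C]
    [SMulCommClass ℂ C C] [AddCommGroup D] [Module ℂ D] (p : C →ₗ[ℂ] D →ₗ[ℂ] ℂ)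
    (m : MultiplierAlgebra C) (f : D →ₗ[ℂ] ℂ) : Prop :=
  (∀ (x : C) (y y' : D), (∀ x', p x' y' = p (x' * x) y) → f y' = p (left m x) y) ∧
  (∀ (x : C) (y y' : D), (∀ x', p x' y' = p (x * x') y) → f y' = p (right m x) y)

namespace AlgebraicQuantumGroup

variable {A : Type*} [NonUnitalRing A] [Module ℂ A] [IsScalarTower ℂ A A] [SMulCommClass ℂ A A]
variable (G : AlgebraicQuantumGroup A)

/-- The functional `a ⊗ b ↦ ⟨a, b⟩` on `A ⊗ B`. -/
def evaluation : A ⊗[ℂ] G.Dual →ₗ[ℂ] ℂ := TensorProduct.lift G.toFunctional.flip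

/-- The pairing of `B ⊗ A` with `A ⊗ B`: `⟨b ⊗ a, a' ⊗ b'⟩ = ⟨a', b⟩ ⟨a, b'⟩`. -/
def tensorPairing : G.Dual ⊗[ℂ] A →ₗ[ℂ] A ⊗[ℂ] G.Dual →ₗ[ℂ] ℂ :=
  TensorProduct.lift <| LinearMap.mk₂ ℂ
    (fun b a => LinearMap.mul' ℂ ℂ ∘ₗ TensorProduct.map (G.toFunctional b) (G.toFunctional.flip a))
    (fun _ _ _ => by ext; simp [add_mul]) (fun _ _ _ => by ext; simp [mul_assoc])
    (fun _ _ _ => by ext; simp [mul_add]) (fun _ _ _ => by ext; simp [mul_left_comm])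

theorem evaluation_tmul (a : A) (b : G.Dual) : G.evaluation (a ⊗ₜ b) = G.pair a b := rfl

theorem tensorPairing_tmul (b b' : G.Dual) (a a' : A) :
    G.tensorPairing (b ⊗ₜ a) (a' ⊗ₜ b') = G.pair a' b * G.pair a b' := rfl

/-- `⟨V, a ⊗ b⟩ = ⟨a, b⟩` for all `a` and `b`, with the pairing extended to
`M(B ⊗ A) × (A ⊗ B)`. -/
def IsDuality (V : MultiplierAlgebra (G.Dual ⊗[ℂ] A)) : Prop :=
  IsExtendedPairing G.tensorPairing V G.evaluation

/-- Formula for `V` as a left multiplier, for `b = φ(c ·)`: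
`V(b ⊗ a) = ∑ φ(c₂ ·) ⊗ S(c₁)a`, where `S(c₁)a ⊗ c₂ = (S ⊗ ι)((S⁻¹(a) ⊗ 1)Δ(c))`.
The equation is read in `A' ⊗ A`, where `A'` is the space of all functionals on `A`. -/
def LeftFormula (V : MultiplierAlgebra (G.Dual ⊗[ℂ] A)) : Prop :=
  ∀ (a c : A) (b : G.Dual), G.toFunctional b = mulLeftFunctional G.φ c →
    G.toFunctional.rTensor A (left V (b ⊗ₜ a))
      = TensorProduct.map (mulLeftFunctional G.φ) G.S.toLinearMap
          (TensorProduct.comm ℂ A A (G.T₂ (G.S.symm a ⊗ₜ c)))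

/-- Formula for `V` as a right multiplier, for `b = ψ(· c)`:
`(b ⊗ a)V = ∑ ψ(· c₁) ⊗ aS(c₂)`, where `c₁ ⊗ aS(c₂) = (ι ⊗ S)(Δ(c)(1 ⊗ S⁻¹(a)))`. -/
def RightFormula (V : MultiplierAlgebra (G.Dual ⊗[ℂ] A)) : Prop :=
  ∀ (a c : A) (b : G.Dual), G.toFunctional b = mulRightFunctional G.ψ c →
    G.toFunctional.rTensor A (right V (b ⊗ₜ a))
      = TensorProduct.map (mulRightFunctional G.ψ) G.S.toLinearMap (G.T₁ (c ⊗ₜ G.S.symm a))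

/-- `W = (ι ⊗ S)V` in `M(B ⊗ A)`. As `S` is an anti-homomorphism of `A`, this means
`W(b ⊗ S(a)) = (ι ⊗ S)((1 ⊗ a)V(b ⊗ 1))` and `(b ⊗ S(a))W = (ι ⊗ S)((b ⊗ 1)V(1 ⊗ a))`, where
`(1 ⊗ a)V(b ⊗ 1)` and `(b ⊗ 1)V(1 ⊗ a)` belong to `B ⊗ A`. -/
def IsAntipodeSnd (V W : MultiplierAlgebra (G.Dual ⊗[ℂ] A)) : Prop :=
  ∀ (a : A) (b : G.Dual),
    (∃ x : G.Dual ⊗[ℂ] A, embed x = inr a * V * inl b ∧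
      left W (b ⊗ₜ G.S a) = G.S.toLinearMap.lTensor G.Dual x) ∧
    (∃ y : G.Dual ⊗[ℂ] A, embed y = inl b * V * inr a ∧
      right W (b ⊗ₜ G.S a) = G.S.toLinearMap.lTensor G.Dual y)

/-- `W = (S ⊗ ι)V` in `M(B ⊗ A)`. As `S` is an anti-homomorphism of `B`, this means
`W(S(b) ⊗ a) = (S ⊗ ι)((b ⊗ 1)V(1 ⊗ a))` and `(S(b) ⊗ a)W = (S ⊗ ι)((1 ⊗ a)V(b ⊗ 1))`, where
`(b ⊗ 1)V(1 ⊗ a)` and `(1 ⊗ a)V(b ⊗ 1)` belong to `B ⊗ A`. -/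
def IsAntipodeFst (V W : MultiplierAlgebra (G.Dual ⊗[ℂ] A)) : Prop :=
  ∀ (a : A) (b : G.Dual),
    (∃ y : G.Dual ⊗[ℂ] A, embed y = inl b * V * inr a ∧
      left W (G.dualS b ⊗ₜ a) = G.dualS.toLinearMap.rTensor A y) ∧
    (∃ x : G.Dual ⊗[ℂ] A, embed x = inr a * V * inl b ∧
      right W (G.dualS b ⊗ₜ a) = G.dualS.toLinearMap.rTensor A x)

end AlgebraicQuantumGroup

end

/-!
With `B` inside the space `A'` of functionals on `A`, a multiplier `m` of `B ⊗ A` is determined by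
its slices: if slicing `m` at `a'` gives `θ(a')`, then slicing `m(b ⊗ a)` and `(b ⊗ a)m` at `a'`
gives `θ(b ▷ a')a` and `aθ(a' ◁ b)`. The pairing condition `⟨V, a ⊗ b⟩ = ⟨a, b⟩` says that `θ` is
the identity, and both `⟨S(a), b⟩` and `⟨a, S(b)⟩` correspond to `θ = S`; so `(ι ⊗ S)V` and
`(S ⊗ ι)V` are the same multiplier, by `S(S(b) ▷ a) = S(a) ◁ b` and `S(a ◁ S(b)) = b ▷ S(a)`.

That these slices come from maps of `B ⊗ A` into itself rests on strong left invariance,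
`S((ι ⊗ φ)(Δ(a)(1 ⊗ b))) = (ι ⊗ φ)((1 ⊗ a)Δ(b))`. By left invariance the two slices vanish
simultaneously, so the same formula defines the antipode; it then gives `Δ ∘ S = σ(S ⊗ S)Δ`, the
right invariance of `ψ = φ ∘ S`, the faithfulness of `φ` and the descriptions of `B`.
-/

noncomputable section

open MultiplierAlgebra

section Slice

variable {U V V' W W' : Type*} [AddCommGroup U] [Module ℂ U] [AddCommGroup V] [Module ℂ V]
  [AddCommGroup W] [Module ℂ W] [AddCommGroup V'] [Module ℂ V'] [AddCommGroup W'] [Module ℂ W']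

theorem sliceRight_rTensor (f : V →ₗ[ℂ] V') (ω : W →ₗ[ℂ] ℂ) (z : V ⊗[ℂ] W) :
    sliceRight ω (f.rTensor W z) = f (sliceRight ω z) := by
  induction z <;> simp_all

theorem sliceRight_lTensor (f : W →ₗ[ℂ] W') (ω : W' →ₗ[ℂ] ℂ) (z : V ⊗[ℂ] W) :
    sliceRight ω (f.lTensor V z) = sliceRight (ω ∘ₗ f) z := by
  induction z <;> simp_all

theorem sliceLeft_lTensor (f : W →ₗ[ℂ] W') (ω : V →ₗ[ℂ] ℂ) (z : V ⊗[ℂ] W) :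
    sliceLeft ω (f.lTensor V z) = f (sliceLeft ω z) := by
  induction z <;> simp_all

theorem sliceLeft_rTensor (f : V →ₗ[ℂ] V') (ω : V' →ₗ[ℂ] ℂ) (z : V ⊗[ℂ] W) :
    sliceLeft ω (f.rTensor W z) = sliceLeft (ω ∘ₗ f) z := by
  induction z <;> simp_all

theorem sliceLeft_comm (ω : W →ₗ[ℂ] ℂ) (z : V ⊗[ℂ] W) :
    sliceLeft ω (TensorProduct.comm ℂ V W z) = sliceRight ω z := by
  induction z <;> simp_all

theorem apply_sliceRight (ω : V →ₗ[ℂ] ℂ) (θ : W →ₗ[ℂ] ℂ) (z : V ⊗[ℂ] W) :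
    ω (sliceRight θ z) = θ (sliceLeft ω z) := by
  induction z <;> simp_all [mul_comm]

theorem lTensor_sliceRight_assoc (ω : W →ₗ[ℂ] ℂ) (z : (U ⊗[ℂ] V) ⊗[ℂ] W) :
    (sliceRight ω).lTensor U (TensorProduct.assoc ℂ U V W z) = sliceRight ω z := by
  refine LinearMap.congr_fun (f := (sliceRight ω).lTensor U ∘ₗ
    (TensorProduct.assoc ℂ U V W).toLinearMap) (TensorProduct.ext_threefold fun u v w => ?_) z
  simp

theorem sliceLeft_assoc (ω : U →ₗ[ℂ] ℂ) (z : (U ⊗[ℂ] V) ⊗[ℂ] W) :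
    sliceLeft ω (TensorProduct.assoc ℂ U V W z) = (sliceLeft ω).rTensor W z := by
  refine LinearMap.congr_fun (f := sliceLeft ω ∘ₗ
    (TensorProduct.assoc ℂ U V W).toLinearMap) (TensorProduct.ext_threefold fun u v w => ?_) z
  simp [TensorProduct.smul_tmul']

theorem lTensor_smulRight (ω : W →ₗ[ℂ] ℂ) (w : W') (z : V ⊗[ℂ] W) :
    (ω.smulRight w).lTensor V z = sliceRight ω z ⊗ₜ[ℂ] w := by
  induction z <;> simp_all [TensorProduct.add_tmul, TensorProduct.smul_tmul]

theorem sliceRight_surjective {ω : W →ₗ[ℂ] ℂ} (h : ω ≠ 0) :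
    Function.Surjective (sliceRight ω : V ⊗[ℂ] W → V) := fun v => by
  obtain ⟨w, hw⟩ := LinearMap.surjective h 1
  exact ⟨v ⊗ₜ w, by simp [hw]⟩

theorem sliceLeft_surjective {ω : V →ₗ[ℂ] ℂ} (h : ω ≠ 0) :
    Function.Surjective (sliceLeft ω : V ⊗[ℂ] W → W) := fun w => by
  obtain ⟨v, hv⟩ := LinearMap.surjective h 1
  exact ⟨v ⊗ₜ w, by simp [hv]⟩

theorem rTensor_lTensor_comm (f : V →ₗ[ℂ] V') (g : W →ₗ[ℂ] W') (z : V ⊗[ℂ] W) :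
    f.rTensor W' (g.lTensor V z) = g.lTensor V' (f.rTensor W z) := by
  induction z <;> simp_all

theorem lTensor_assoc_tmul (f : V ⊗[ℂ] W →ₗ[ℂ] V') (z : U ⊗[ℂ] V) (w : W) :
    f.lTensor U (TensorProduct.assoc ℂ U V W (z ⊗ₜ w))
      = (f ∘ₗ (TensorProduct.mk ℂ V W).flip w).lTensor U z := by
  induction z <;> simp_all [TensorProduct.add_tmul]

theorem rTensor_assoc_symm_tmul (f : U ⊗[ℂ] V →ₗ[ℂ] V') (u : U) (z : V ⊗[ℂ] W) :
    f.rTensor W ((TensorProduct.assoc ℂ U V W).symm (u ⊗ₜ z))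
      = (f ∘ₗ TensorProduct.mk ℂ U V u).rTensor W z := by
  induction z <;> simp_all [TensorProduct.tmul_add]

theorem eq_of_rTensor {ι : Type*} (F : ι → V →ₗ[ℂ] V') (hF : ∀ v, (∀ i, F i v = 0) → v = 0)
    {z z' : V ⊗[ℂ] W} (h : ∀ i, (F i).rTensor W z = (F i).rTensor W z') : z = z' := by
  rw [← sub_eq_zero]
  refine eq_zero_of_sliceRight _ fun ω => hF _ fun i => ?_
  rw [← sliceRight_rTensor, map_sub, h, sub_self, map_zero]

theorem eq_of_lTensor {ι : Type*} (F : ι → W →ₗ[ℂ] W') (hF : ∀ w, (∀ i, F i w = 0) → w = 0)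
    {z z' : V ⊗[ℂ] W} (h : ∀ i, (F i).lTensor V z = (F i).lTensor V z') : z = z' := by
  rw [← sub_eq_zero]
  refine eq_zero_of_sliceLeft _ fun ω => hF _ fun i => ?_
  rw [← sliceLeft_lTensor, map_sub, h, sub_self, map_zero]

/-- The slice map `(z, ω) ↦ (ι ⊗ ω)(z)` as a bilinear map. -/
def sliceRightHom : V ⊗[ℂ] W →ₗ[ℂ] (W →ₗ[ℂ] ℂ) →ₗ[ℂ] V :=
  LinearMap.mk₂ ℂ (fun z ω => sliceRight ω z) (fun _ _ _ => map_add _ _ _)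
    (fun _ _ _ => map_smul _ _ _) (fun _ _ _ => by simp [sliceRight, LinearMap.lTensor_add])
    (fun _ _ _ => by simp [sliceRight, LinearMap.lTensor_smul])

@[simp] theorem sliceRightHom_apply (z : V ⊗[ℂ] W) (ω : W →ₗ[ℂ] ℂ) :
    sliceRightHom z ω = sliceRight ω z := rfl

end Slice

theorem exists_linearEquiv_of_ker_eq {R X M N : Type*} [Ring R] [AddCommGroup X] [Module R X]
    [AddCommGroup M] [Module R M] [AddCommGroup N] [Module R N] {f : X →ₗ[R] M} {g : X →ₗ[R] N}
    (hf : Function.Surjective f) (hg : Function.Surjective g)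
    (h : LinearMap.ker f = LinearMap.ker g) : ∃ e : M ≃ₗ[R] N, ∀ x, e (f x) = g x := by
  refine ⟨(f.quotKerEquivOfSurjective hf).symm ≪≫ₗ Submodule.quotEquivOfEq _ _ h ≪≫ₗ
    g.quotKerEquivOfSurjective hg, fun x => ?_⟩
  have h_symm : (f.quotKerEquivOfSurjective hf).symm (f x) = Submodule.Quotient.mk x :=
    (LinearEquiv.symm_apply_eq _).2 rfl
  simp only [LinearEquiv.trans_apply, h_symm]
  rfl

theorem range_eq_of_comp_eq_comp {R X M M' N : Type*} [Ring R] [AddCommGroup X] [Module R X]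
    [AddCommGroup M] [Module R M] [AddCommGroup M'] [Module R M'] [AddCommGroup N] [Module R N]
    {f : M →ₗ[R] N} {g : M' →ₗ[R] N} {s : X →ₗ[R] M} {t : X →ₗ[R] M'}
    (hs : Function.Surjective s) (ht : Function.Surjective t) (h : f ∘ₗ s = g ∘ₗ t) :
    LinearMap.range f = LinearMap.range g := by
  rw [← LinearMap.range_comp_of_range_eq_top f (LinearMap.range_eq_top.2 hs), h,
    LinearMap.range_comp_of_range_eq_top g (LinearMap.range_eq_top.2 ht)]

namespace NondegenerateProduct

variable {C : Type*} [NonUnitalRing C] (hC : NondegenerateProduct C)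
include hC

theorem eq_of_mul_left {x y : C} (h : ∀ z, z * x = z * y) : x = y :=
  sub_eq_zero.1 <| hC.2 _ fun z => by rw [mul_sub, h, sub_self]

theorem eq_of_mul_right {x y : C} (h : ∀ z, x * z = y * z) : x = y :=
  sub_eq_zero.1 <| hC.1 _ fun z => by rw [sub_mul, h, sub_self]

variable [Module ℂ C] {V : Type*} [AddCommGroup V] [Module ℂ V]

theorem eq_of_rTensor_mulLeft [SMulCommClass ℂ C C] {z z' : C ⊗[ℂ] V}
    (h : ∀ t, (LinearMap.mulLeft ℂ t).rTensor V z = (LinearMap.mulLeft ℂ t).rTensor V z') :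
    z = z' :=
  eq_of_rTensor _ hC.2 h

theorem eq_of_rTensor_mulRight [IsScalarTower ℂ C C] {z z' : C ⊗[ℂ] V}
    (h : ∀ t, (LinearMap.mulRight ℂ t).rTensor V z = (LinearMap.mulRight ℂ t).rTensor V z') :
    z = z' :=
  eq_of_rTensor _ hC.1 h

theorem eq_of_lTensor_mulRight [IsScalarTower ℂ C C] {z z' : V ⊗[ℂ] C}
    (h : ∀ t, (LinearMap.mulRight ℂ t).lTensor V z = (LinearMap.mulRight ℂ t).lTensor V z') :
    z = z' :=
  eq_of_lTensor _ hC.1 h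

end NondegenerateProduct

theorem MultiplierAlgebra.inl_mul_inr {C D : Type*}
    [NonUnitalRing C] [Module ℂ C] [IsScalarTower ℂ C C] [SMulCommClass ℂ C C]
    [NonUnitalRing D] [Module ℂ D] [IsScalarTower ℂ D D] [SMulCommClass ℂ D D] (c : C) (d : D) :
    (inl c * inr d : MultiplierAlgebra (C ⊗[ℂ] D)) = inr d * inl c := by
  ext x
  · exact rTensor_lTensor_comm _ _ x
  · exact (rTensor_lTensor_comm _ _ x).symm

theorem MultiplierAlgebra.ext_tmul {C D : Type*}
    [NonUnitalRing C] [Module ℂ C] [IsScalarTower ℂ C C] [SMulCommClass ℂ C C]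
    [NonUnitalRing D] [Module ℂ D] [IsScalarTower ℂ D D] [SMulCommClass ℂ D D]
    {m n : MultiplierAlgebra (C ⊗[ℂ] D)} (hl : ∀ c d, left m (c ⊗ₜ d) = left n (c ⊗ₜ d))
    (hr : ∀ c d, right m (c ⊗ₜ d) = right n (c ⊗ₜ d)) : m = n := by
  ext z
  · exact LinearMap.congr_fun (TensorProduct.ext' hl) z
  · exact LinearMap.congr_fun (TensorProduct.ext' hr) z

/-! ### Coassociativity -/

namespace Coassociative

variable {A : Type*} [AddCommGroup A] [Module ℂ A] {T T' : A ⊗[ℂ] A →ₗ[ℂ] A ⊗[ℂ] A}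
  (h : Coassociative T T')
include h

theorem apply (a : A) (z : A ⊗[ℂ] A) :
    T.lTensor A (TensorProduct.assoc ℂ A A A
        (T'.rTensor A ((TensorProduct.assoc ℂ A A A).symm (a ⊗ₜ z))))
      = TensorProduct.assoc ℂ A A A
          (T'.rTensor A ((TensorProduct.assoc ℂ A A A).symm (a ⊗ₜ T z))) := by
  induction z with
  | tmul b c => exact (h a b c).symm
  | _ => simp_all [TensorProduct.tmul_add]

theorem apply_tmul_sliceRight (f : A →ₗ[ℂ] ℂ) (a b c : A) :
    T' (a ⊗ₜ sliceRight f (T (b ⊗ₜ c)))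
      = (sliceRight f ∘ₗ T ∘ₗ (TensorProduct.mk ℂ A A).flip c).lTensor A (T' (a ⊗ₜ b)) := by
  have h' := congrArg ((sliceRight f).lTensor A) (h a b c)
  rw [lTensor_sliceRight_assoc, sliceRight_rTensor, ← lTensor_sliceRight_assoc,
    LinearEquiv.apply_symm_apply, LinearMap.lTensor_tmul, lTensor_assoc_tmul] at h'
  rw [h', ← LinearMap.lTensor_comp_apply]

theorem apply_sliceLeft_tmul (f : A →ₗ[ℂ] ℂ) (a b c : A) :
    T (sliceLeft f (T' (a ⊗ₜ b)) ⊗ₜ c)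
      = (sliceLeft f ∘ₗ T' ∘ₗ TensorProduct.mk ℂ A A a).rTensor A (T (b ⊗ₜ c)) := by
  have h' := congrArg (sliceLeft f) (h a b c)
  rw [sliceLeft_assoc, ← LinearMap.rTensor_comp_apply, rTensor_assoc_symm_tmul, sliceLeft_lTensor,
    sliceLeft_assoc, LinearMap.rTensor_tmul] at h'
  exact h'.symm

end Coassociative

/-! ### Compatibility of the canonical maps -/

namespace RegularMultiplierHopfAlgebra

variable {A : Type*} [NonUnitalRing A] [Module ℂ A] [IsScalarTower ℂ A A] [SMulCommClass ℂ A A]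
variable (H : RegularMultiplierHopfAlgebra A)

include H in
theorem embed_tensor_injective :
    Function.Injective (embed : A ⊗[ℂ] A → MultiplierAlgebra (A ⊗[ℂ] A)) :=
  embed_injective (H.nondegenerate.tensor H.nondegenerate)

theorem rTensor_mulLeft_T₁ (t a b : A) : (LinearMap.mulLeft ℂ t).rTensor A (H.T₁ (a ⊗ₜ b))
    = (LinearMap.mulRight ℂ b).lTensor A (H.T₂ (t ⊗ₜ a)) := by
  apply H.embed_tensor_injective
  rw [← left_inl, ← right_inr, ← mul_embed, ← embed_mul, H.embed_T₁, H.embed_T₂, mul_assoc]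

theorem rTensor_mulRight_T₁ (t a b : A) : (LinearMap.mulRight ℂ t).rTensor A (H.T₁ (a ⊗ₜ b))
    = (LinearMap.mulRight ℂ b).lTensor A (H.T₃ (a ⊗ₜ t)) := by
  apply H.embed_tensor_injective
  rw [← right_inl, ← right_inr, ← embed_mul, ← embed_mul, H.embed_T₁, H.embed_T₃, mul_assoc,
    mul_assoc, inl_mul_inr]

theorem lTensor_mulLeft_T₁ (t a b : A) : (LinearMap.mulLeft ℂ t).lTensor A (H.T₁ (a ⊗ₜ b))
    = (LinearMap.mulRight ℂ b).lTensor A (H.T₄ (t ⊗ₜ a)) := by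
  apply H.embed_tensor_injective
  rw [← left_inr, ← right_inr, ← mul_embed, ← embed_mul, H.embed_T₁, H.embed_T₄, mul_assoc]

theorem rTensor_mulLeft_T₃ (t a b : A) : (LinearMap.mulLeft ℂ t).rTensor A (H.T₃ (a ⊗ₜ b))
    = (LinearMap.mulRight ℂ b).rTensor A (H.T₂ (t ⊗ₜ a)) := by
  apply H.embed_tensor_injective
  rw [← left_inl, ← right_inl, ← mul_embed, ← embed_mul, H.embed_T₃, H.embed_T₂, mul_assoc]

theorem lTensor_mulLeft_T₃ (t a b : A) : (LinearMap.mulLeft ℂ t).lTensor A (H.T₃ (a ⊗ₜ b))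
    = (LinearMap.mulRight ℂ b).rTensor A (H.T₄ (t ⊗ₜ a)) := by
  apply H.embed_tensor_injective
  rw [← left_inr, ← right_inl, ← mul_embed, ← embed_mul, H.embed_T₃, H.embed_T₄, mul_assoc]

theorem lTensor_mulLeft_T₂ (t s a : A) : (LinearMap.mulLeft ℂ t).lTensor A (H.T₂ (s ⊗ₜ a))
    = (LinearMap.mulLeft ℂ s).rTensor A (H.T₄ (t ⊗ₜ a)) := by
  apply H.embed_tensor_injective
  rw [← left_inr, ← left_inl, ← mul_embed, ← mul_embed, H.embed_T₂, H.embed_T₄, ← mul_assoc,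
    ← mul_assoc, inl_mul_inr]

theorem left_comul_tmul (a c d : A) : left (H.comul a) (c ⊗ₜ d)
    = (LinearMap.mulRight ℂ c).rTensor A (H.T₁ (a ⊗ₜ d)) := by
  apply H.embed_tensor_injective
  rw [← right_inl, ← embed_mul, ← mul_embed, H.embed_T₁, mul_assoc, inr_mul_inl]

theorem right_comul_tmul (a c d : A) : right (H.comul a) (c ⊗ₜ d)
    = (LinearMap.mulLeft ℂ d).lTensor A (H.T₂ (c ⊗ₜ a)) := by
  apply H.embed_tensor_injective
  rw [← left_inr, ← embed_mul, ← mul_embed, H.embed_T₂, ← mul_assoc, inr_mul_inl]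

theorem left_comul_T₁ (a : A) (z : A ⊗[ℂ] A) :
    left (H.comul a) (H.T₁ z) = H.T₁ ((LinearMap.mulLeft ℂ a).rTensor A z) := by
  induction z with
  | tmul b c =>
    apply H.embed_tensor_injective
    simp [← mul_embed, H.embed_T₁, mul_assoc]
  | _ => simp_all

theorem left_comul_T₃ (a : A) (z : A ⊗[ℂ] A) :
    left (H.comul a) (H.T₃ z) = H.T₃ ((LinearMap.mulLeft ℂ a).rTensor A z) := by
  induction z with
  | tmul b c =>
    apply H.embed_tensor_injective
    simp [← mul_embed, H.embed_T₃, mul_assoc]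
  | _ => simp_all

theorem right_comul_T₂ (a : A) (z : A ⊗[ℂ] A) :
    right (H.comul a) (H.T₂ z) = H.T₂ ((LinearMap.mulRight ℂ a).lTensor A z) := by
  induction z with
  | tmul b c =>
    apply H.embed_tensor_injective
    simp [← embed_mul, H.embed_T₂, mul_assoc]
  | _ => simp_all

theorem right_comul_T₄ (a : A) (z : A ⊗[ℂ] A) :
    right (H.comul a) (H.T₄ z) = H.T₄ ((LinearMap.mulRight ℂ a).lTensor A z) := by
  induction z with
  | tmul b c =>
    apply H.embed_tensor_injective
    simp [← embed_mul, H.embed_T₄, mul_assoc]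
  | _ => simp_all

/-- The slice map `a ↦ a₁ f(a₂ s)` of the coproduct. -/
def sliceT₁ (f : A →ₗ[ℂ] ℂ) (s : A) : A →ₗ[ℂ] A :=
  sliceRight f ∘ₗ H.T₁.toLinearMap ∘ₗ (TensorProduct.mk ℂ A A).flip s

/-- The slice map `a ↦ a₁ f(s a₂)` of the coproduct. -/
def sliceT₄ (f : A →ₗ[ℂ] ℂ) (s : A) : A →ₗ[ℂ] A :=
  sliceRight f ∘ₗ H.T₄.toLinearMap ∘ₗ TensorProduct.mk ℂ A A s

@[simp] theorem sliceT₁_apply (f : A →ₗ[ℂ] ℂ) (s a : A) :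
    H.sliceT₁ f s a = sliceRight f (H.T₁ (a ⊗ₜ s)) := rfl

@[simp] theorem sliceT₄_apply (f : A →ₗ[ℂ] ℂ) (s a : A) :
    H.sliceT₄ f s a = sliceRight f (H.T₄ (s ⊗ₜ a)) := rfl

theorem T₂_sliceT₁ (f : A →ₗ[ℂ] ℂ) (t s a : A) :
    H.T₂ (t ⊗ₜ H.sliceT₁ f s a) = (H.sliceT₁ f s).lTensor A (H.T₂ (t ⊗ₜ a)) :=
  H.coassoc.apply_tmul_sliceRight f t a s

theorem T₃_sliceT₄ (f : A →ₗ[ℂ] ℂ) (s a t : A) :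
    H.T₃ (H.sliceT₄ f s a ⊗ₜ t) = (H.sliceT₄ f s).lTensor A (H.T₃ (a ⊗ₜ t)) := by
  have h := H.coassoc_cop.apply_sliceLeft_tmul f s a t
  simp only [LinearMap.comp_apply, LinearEquiv.coe_coe, sliceLeft_comm,
    LinearMap.rTensor_comm] at h
  rw [sliceT₄_apply, (TensorProduct.comm ℂ A A).injective h]
  congr 2
  ext b
  simp [sliceLeft_comm]

theorem T₂_sliceT₄ (f : A →ₗ[ℂ] ℂ) (t s a : A) :
    H.T₂ (t ⊗ₜ H.sliceT₄ f s a) = (H.sliceT₄ f s).lTensor A (H.T₂ (t ⊗ₜ a)) := by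
  refine H.nondegenerate.eq_of_rTensor_mulRight fun r => ?_
  rw [← rTensor_mulLeft_T₃, T₃_sliceT₄, rTensor_lTensor_comm, rTensor_lTensor_comm,
    rTensor_mulLeft_T₃]

/-! ### The counit -/

theorem lTensor_mul'_T₂ (a : A) (z : A ⊗[ℂ] A) :
    (LinearMap.mul' ℂ A).lTensor A (TensorProduct.assoc ℂ A A A
        (H.T₂.toLinearMap.rTensor A ((TensorProduct.assoc ℂ A A A).symm (a ⊗ₜ z))))
      = (LinearMap.mulLeft ℂ a).rTensor A (H.T₁ z) := by
  induction z with
  | tmul b c =>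
    rw [TensorProduct.assoc_symm_tmul, LinearMap.rTensor_tmul, lTensor_assoc_tmul,
      rTensor_mulLeft_T₁]
    rfl
  | _ => simp_all [TensorProduct.tmul_add]

theorem lTensor_mul'_T₁_symm_T₂ (z : A ⊗[ℂ] A) (c : A) :
    (LinearMap.mul' ℂ A ∘ₗ H.T₁.symm.toLinearMap).lTensor A
        (TensorProduct.assoc ℂ A A A (H.T₂ z ⊗ₜ c)) = LinearMap.mul' ℂ A z ⊗ₜ c := by
  induction z with
  | tmul a b =>
    have h := H.coassoc.apply a (H.T₁.symm (b ⊗ₜ c))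
    rw [LinearEquiv.coe_coe, LinearEquiv.apply_symm_apply, TensorProduct.assoc_symm_tmul,
      LinearMap.rTensor_tmul, LinearEquiv.coe_coe] at h
    rw [← h, ← LinearMap.lTensor_comp_apply, LinearMap.comp_assoc, LinearEquiv.symm_comp,
      LinearMap.comp_id, lTensor_mul'_T₂, LinearEquiv.apply_symm_apply]
    simp
  | _ => simp_all [TensorProduct.add_tmul]

theorem tmul_mul'_T₁_symm (a b c : A) :
    a ⊗ₜ[ℂ] LinearMap.mul' ℂ A (H.T₁.symm (b ⊗ₜ c))
      = LinearMap.mul' ℂ A (H.T₂.symm (a ⊗ₜ b)) ⊗ₜ[ℂ] c := by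
  simpa using H.lTensor_mul'_T₁_symm_T₂ (H.T₂.symm (a ⊗ₜ b)) c

theorem exists_isCounit : ∃ ε, H.IsCounit ε := by
  rcases subsingleton_or_nontrivial A with _ | _
  · exact ⟨0, fun _ _ => Subsingleton.elim _ _, fun _ _ => Subsingleton.elim _ _⟩
  obtain ⟨p, hp⟩ := exists_ne (0 : A)
  obtain ⟨ω, hω⟩ := Module.Projective.exists_dual_eq_one ℂ hp
  let ε : A →ₗ[ℂ] ℂ := ω ∘ₗ LinearMap.mul' ℂ A ∘ₗ H.T₂.symm.toLinearMap ∘ₗ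
    TensorProduct.mk ℂ A A p
  have mul'_T₁_symm_tmul (a b : A) : LinearMap.mul' ℂ A (H.T₁.symm (a ⊗ₜ b)) = ε a • b := by
    simpa [hω, ε] using congrArg (sliceLeft ω) (H.tmul_mul'_T₁_symm p a b)
  have mul'_T₂_symm_tmul (a b : A) : LinearMap.mul' ℂ A (H.T₂.symm (a ⊗ₜ b)) = ε b • a := by
    simpa [hω, mul'_T₁_symm_tmul] using (congrArg (sliceRight ω) (H.tmul_mul'_T₁_symm a b p)).symm
  have mul'_T₁_symm : LinearMap.mul' ℂ A ∘ₗ H.T₁.symm.toLinearMap = sliceLeft ε :=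
    TensorProduct.ext' fun a b => by simp [mul'_T₁_symm_tmul]
  have mul'_T₂_symm : LinearMap.mul' ℂ A ∘ₗ H.T₂.symm.toLinearMap = sliceRight ε :=
    TensorProduct.ext' fun a b => by simp [mul'_T₂_symm_tmul]
  exact ⟨ε, fun a b => by simp [← mul'_T₁_symm], fun a b => by simp [← mul'_T₂_symm]⟩

namespace IsCounit

variable {H} {ε : A →ₗ[ℂ] ℂ} (hε : H.IsCounit ε)
include hε

theorem sliceLeft_T₁ (z : A ⊗[ℂ] A) : sliceLeft ε (H.T₁ z) = LinearMap.mul' ℂ A z := by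
  induction z <;> simp_all [hε.1]

theorem sliceLeft_T₄ (s a : A) : sliceLeft ε (H.T₄ (s ⊗ₜ a)) = s * a := by
  refine H.nondegenerate.eq_of_mul_right fun t => ?_
  have h := congrArg (sliceLeft ε) (H.lTensor_mulLeft_T₁ s a t)
  rw [sliceLeft_lTensor, sliceLeft_lTensor, hε.1] at h
  simpa [mul_assoc] using h.symm

theorem sliceRight_T₃ (a b : A) : sliceRight ε (H.T₃ (a ⊗ₜ b)) = a * b := by
  refine H.nondegenerate.eq_of_mul_left fun t => ?_
  have h := congrArg (sliceRight ε) (H.rTensor_mulLeft_T₃ t a b)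
  rw [sliceRight_rTensor, sliceRight_rTensor, hε.2] at h
  simpa [mul_assoc] using h

theorem mul'_T₁_symm (a b : A) : LinearMap.mul' ℂ A (H.T₁.symm (a ⊗ₜ b)) = ε a • b := by
  rw [← hε.sliceLeft_T₁, LinearEquiv.apply_symm_apply, sliceLeft_tmul]

theorem unique {ε' : A →ₗ[ℂ] ℂ} (hε' : H.IsCounit ε') : ε = ε' := by
  ext a
  rcases eq_or_ne a 0 with rfl | ha
  · simp
  · refine smul_left_injective ℂ ha ?_
    simp only [← hε.mul'_T₁_symm, ← hε'.mul'_T₁_symm]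

theorem ne_zero [Nontrivial A] : ε ≠ 0 := by
  rintro rfl
  obtain ⟨p, hp⟩ := exists_ne (0 : A)
  exact hp (H.nondegenerate.1 p fun b => by rw [← hε.1]; simp [sliceLeft])

theorem mul'_surjective : Function.Surjective (LinearMap.mul' ℂ A) := fun a => by
  nontriviality A
  obtain ⟨z, hz⟩ := sliceLeft_surjective (W := A) hε.ne_zero a
  exact ⟨H.T₁.symm z, by rw [← hε.sliceLeft_T₁, LinearEquiv.apply_symm_apply, hz]⟩

theorem sliceLeft_comul (a : A) (z : A ⊗[ℂ] A) :
    sliceLeft ε (left (H.comul a) z) = a * sliceLeft ε z := by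
  obtain ⟨w, rfl⟩ := H.T₁.surjective z
  rw [left_comul_T₁, hε.sliceLeft_T₁, hε.sliceLeft_T₁]
  induction w <;> simp_all [mul_add, mul_assoc]

theorem map_mul (a b : A) : ε (a * b) = ε a * ε b := by
  rcases eq_or_ne b 0 with rfl | hb
  · simp
  have sliceLeft_T₁_mulRight (z : A ⊗[ℂ] A) :
      sliceLeft (ε ∘ₗ LinearMap.mulRight ℂ b) (H.T₁ z) = ε b • sliceLeft ε (H.T₁ z) := by
    induction z with
    | tmul x y =>
      rw [← sliceLeft_rTensor, ← left_comul_tmul, hε.sliceLeft_comul, hε.1]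
      simp [mul_smul_comm]
    | _ => simp_all
  have h := sliceLeft_T₁_mulRight (H.T₁.symm (a ⊗ₜ b))
  rw [LinearEquiv.apply_symm_apply, sliceLeft_tmul, sliceLeft_tmul, smul_smul, mul_comm] at h
  exact smul_left_injective ℂ hb h

end IsCounit

/-! ### The antipode -/

/-- The left multiplications `z ↦ a ↦ Δ(a) z` by the coproduct. -/
def comulLeft : A ⊗[ℂ] A →ₗ[ℂ] A →ₗ[ℂ] A ⊗[ℂ] A :=
  LinearMap.mk₂ ℂ (fun z a => left (H.comul a) z) (fun _ _ _ => map_add _ _ _)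
    (fun _ _ _ => map_smul _ _ _) (fun _ _ _ => by rw [map_add]; rfl)
    (fun _ _ _ => by rw [map_smul]; rfl)

/-- The right multiplications `z ↦ a ↦ z Δ(a)` by the coproduct. -/
def comulRight : A ⊗[ℂ] A →ₗ[ℂ] A →ₗ[ℂ] A ⊗[ℂ] A :=
  LinearMap.mk₂ ℂ (fun z a => right (H.comul a) z) (fun _ _ _ => map_add _ _ _)
    (fun _ _ _ => map_smul _ _ _) (fun _ _ _ => by rw [map_add]; rfl)
    (fun _ _ _ => by rw [map_smul]; rfl)

@[simp] theorem comulLeft_apply (z : A ⊗[ℂ] A) (a : A) :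
    H.comulLeft z a = left (H.comul a) z := rfl

@[simp] theorem comulRight_apply (z : A ⊗[ℂ] A) (a : A) :
    H.comulRight z a = right (H.comul a) z := rfl

theorem sliceRight_comulLeft_tmul (f : A →ₗ[ℂ] ℂ) (r s : A) :
    sliceRight f ∘ₗ H.comulLeft (r ⊗ₜ s) = LinearMap.mulRight ℂ r ∘ₗ H.sliceT₁ f s := by
  ext a
  simp [left_comul_tmul, sliceRight_rTensor]

theorem sliceRight_comulRight_tmul (f : A →ₗ[ℂ] ℂ) (r s : A) :
    sliceRight f ∘ₗ H.comulRight (r ⊗ₜ s) = LinearMap.mulLeft ℂ r ∘ₗ H.sliceT₄ f s := by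
  ext a
  simp [right_comul_tmul, lTensor_mulLeft_T₂, sliceRight_rTensor]

/-- For `z = r ⊗ s`, both sides are `t a₁ ⊗ a₂ r f(a₃ s)`. -/
theorem rTensor_mulLeft_T₁_comm_lTensor (f : A →ₗ[ℂ] ℂ) (t a : A) (z : A ⊗[ℂ] A) :
    (LinearMap.mulLeft ℂ t).rTensor A (H.T₁ (TensorProduct.comm ℂ A A
        ((sliceRight f ∘ₗ H.T₁.toLinearMap ∘ₗ TensorProduct.mk ℂ A A a).lTensor A z)))
      = (sliceRight f ∘ₗ H.comulLeft z).lTensor A (H.T₂ (t ⊗ₜ a)) := by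
  induction z with
  | tmul r s =>
    rw [sliceRight_comulLeft_tmul, LinearMap.lTensor_comp_apply A (LinearMap.mulRight ℂ r),
      ← T₂_sliceT₁, ← rTensor_mulLeft_T₁]
    rfl
  | _ => simp_all [LinearMap.comp_add, LinearMap.lTensor_add]

/-- For `z = r ⊗ s`, both sides are `a₁ t ⊗ r a₂ f(s a₃)`. -/
theorem rTensor_mulRight_T₄_lTensor (f : A →ₗ[ℂ] ℂ) (t a : A) (z : A ⊗[ℂ] A) :
    (LinearMap.mulRight ℂ t).rTensor A (H.T₄
        ((sliceRight f ∘ₗ H.T₄.toLinearMap ∘ₗ (TensorProduct.mk ℂ A A).flip a).lTensor A z))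
      = (sliceRight f ∘ₗ H.comulRight z).lTensor A (H.T₃ (a ⊗ₜ t)) := by
  induction z with
  | tmul r s =>
    rw [sliceRight_comulRight_tmul, LinearMap.lTensor_comp_apply A (LinearMap.mulLeft ℂ r),
      ← T₃_sliceT₄, lTensor_mulLeft_T₃]
    rfl
  | _ => simp_all [LinearMap.comp_add, LinearMap.lTensor_add]

namespace IsLeftIntegral

variable {H} {φ : A →ₗ[ℂ] ℂ} (hφ : H.IsLeftIntegral φ)
include hφ

/-- `(a₁ ⊗ a₂ b₁ q) φ(a₃ b₂) = a₁ φ(a₂ b) ⊗ q`, by left invariance. -/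
theorem T₁_comm_lTensor_T₃ (a b q : A) :
    H.T₁ (TensorProduct.comm ℂ A A ((sliceRight φ ∘ₗ H.T₁.toLinearMap ∘ₗ
      TensorProduct.mk ℂ A A a).lTensor A (H.T₃ (b ⊗ₜ q))))
      = sliceRight φ (H.T₁ (a ⊗ₜ b)) ⊗ₜ[ℂ] q := by
  refine H.nondegenerate.eq_of_rTensor_mulLeft fun t => ?_
  have slice_comul : sliceRight φ ∘ₗ H.comulLeft (H.T₃ (b ⊗ₜ q))
      = (φ ∘ₗ LinearMap.mulRight ℂ b).smulRight q := by
    ext a'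
    simp [left_comul_T₃, hφ.2.1]
  rw [rTensor_mulLeft_T₁_comm_lTensor, slice_comul, lTensor_smulRight, ← sliceRight_lTensor,
    ← rTensor_mulLeft_T₁, sliceRight_rTensor]
  rfl

/-- `(a₁ ⊗ q d₁ a₂) φ(d₂ a₃) = a₁ φ(d a₂) ⊗ q`, by left invariance. -/
theorem T₄_lTensor_T₂ (d a q : A) :
    H.T₄ ((sliceRight φ ∘ₗ H.T₄.toLinearMap ∘ₗ
      (TensorProduct.mk ℂ A A).flip a).lTensor A (H.T₂ (q ⊗ₜ d)))
      = sliceRight φ (H.T₄ (d ⊗ₜ a)) ⊗ₜ[ℂ] q := by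
  refine H.nondegenerate.eq_of_rTensor_mulRight fun t => ?_
  have slice_comul : sliceRight φ ∘ₗ H.comulRight (H.T₂ (q ⊗ₜ d))
      = (φ ∘ₗ LinearMap.mulLeft ℂ d).smulRight q := by
    ext a'
    simp [right_comul_T₂, hφ.2.2]
  rw [rTensor_mulRight_T₄_lTensor, slice_comul, lTensor_smulRight, ← sliceRight_lTensor,
    lTensor_mulLeft_T₃, sliceRight_rTensor]
  rfl

theorem sliceLeft_T₁_symm {ε : A →ₗ[ℂ] ℂ} (hε : H.IsCounit ε) (z : A ⊗[ℂ] A) (q : A) :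
    sliceLeft ε (H.T₁.symm (sliceRight φ (H.T₁ z) ⊗ₜ q)) = sliceRight φ (H.T₄ z) * q := by
  induction z with
  | tmul a b =>
    have counit_slice : ε ∘ₗ sliceRight φ ∘ₗ H.T₁.toLinearMap ∘ₗ TensorProduct.mk ℂ A A a
        = φ ∘ₗ LinearMap.mulLeft ℂ a := by
      ext s
      simp [apply_sliceRight, hε.1]
    rw [← hφ.T₁_comm_lTensor_T₃, LinearEquiv.symm_apply_apply, sliceLeft_comm, sliceRight_lTensor,
      counit_slice, ← sliceRight_lTensor, lTensor_mulLeft_T₃, sliceRight_rTensor]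
    rfl
  | _ => simp_all [TensorProduct.add_tmul, add_mul]

theorem sliceRight_T₄_symm {ε : A →ₗ[ℂ] ℂ} (hε : H.IsCounit ε) (z : A ⊗[ℂ] A) (q : A) :
    sliceRight ε (H.T₄.symm (sliceRight φ (H.T₄ z) ⊗ₜ q)) = q * sliceRight φ (H.T₁ z) := by
  induction z with
  | tmul d a =>
    have counit_slice : ε ∘ₗ sliceRight φ ∘ₗ H.T₄.toLinearMap ∘ₗ (TensorProduct.mk ℂ A A).flip a
        = φ ∘ₗ LinearMap.mulRight ℂ a := by
      ext s
      simp [apply_sliceRight, hε.sliceLeft_T₄]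
    rw [← hφ.T₄_lTensor_T₂, LinearEquiv.symm_apply_apply, sliceRight_lTensor, counit_slice,
      ← sliceRight_lTensor, ← rTensor_mulLeft_T₁, sliceRight_rTensor]
    rfl
  | _ => simp_all [TensorProduct.add_tmul, mul_add]

theorem sliceRight_T₁_eq_zero_iff (z : A ⊗[ℂ] A) :
    sliceRight φ (H.T₁ z) = 0 ↔ sliceRight φ (H.T₄ z) = 0 := by
  obtain ⟨ε, hε⟩ := H.exists_isCounit
  refine ⟨fun h => H.nondegenerate.1 _ fun q => ?_, fun h => H.nondegenerate.2 _ fun q => ?_⟩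
  · simp [← hφ.sliceLeft_T₁_symm hε, h]
  · simp [← hφ.sliceRight_T₄_symm hε, h]

/-- The antipode in terms of a left integral: `S(a₁) φ(a₂ b) = b₁ φ(a b₂)`. -/
theorem exists_antipode_formula {ε : A →ₗ[ℂ] ℂ} (hε : H.IsCounit ε) :
    ∃ S : A ≃ₗ[ℂ] A, (∀ z, S (sliceRight φ (H.T₁ z)) = sliceRight φ (H.T₄ z)) ∧
      ∀ p q, S p * q = sliceLeft ε (H.T₁.symm (p ⊗ₜ q)) := by
  have surjective_T₁ : Function.Surjective (sliceRight φ ∘ₗ H.T₁.toLinearMap) :=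
    (sliceRight_surjective hφ.1).comp H.T₁.surjective
  have surjective_T₄ : Function.Surjective (sliceRight φ ∘ₗ H.T₄.toLinearMap) :=
    (sliceRight_surjective hφ.1).comp H.T₄.surjective
  obtain ⟨S, hS⟩ := exists_linearEquiv_of_ker_eq surjective_T₁ surjective_T₄
    (Submodule.ext hφ.sliceRight_T₁_eq_zero_iff)
  refine ⟨S, hS, fun p q => ?_⟩
  obtain ⟨z, rfl⟩ := surjective_T₁ p
  rw [hS]
  exact (hφ.sliceLeft_T₁_symm hε z q).symm

end IsLeftIntegral

namespace IsCounit

variable {H} {ε : A →ₗ[ℂ] ℂ} (hε : H.IsCounit ε)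
include hε

theorem mul'_lTensor_sliceLeft_T₂ (a : A) (z : A ⊗[ℂ] A) :
    LinearMap.mul' ℂ A ((sliceLeft ε).lTensor A (TensorProduct.assoc ℂ A A A
        (H.T₂.toLinearMap.rTensor A ((TensorProduct.assoc ℂ A A A).symm (a ⊗ₜ z)))))
      = a * LinearMap.mul' ℂ A z := by
  induction z with
  | tmul b c =>
    have slice_tmul : sliceLeft ε ∘ₗ (TensorProduct.mk ℂ A A).flip c = ε.smulRight c := by
      ext
      simp
    rw [TensorProduct.assoc_symm_tmul, LinearMap.rTensor_tmul, lTensor_assoc_tmul, slice_tmul,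
      lTensor_smulRight, LinearEquiv.coe_coe, hε.2, LinearMap.mul'_apply, LinearMap.mul'_apply,
      mul_assoc]
  | _ => simp_all [TensorProduct.tmul_add, mul_add]

theorem isAntipode {S : A ≃ₗ[ℂ] A}
    (hS : ∀ p q, S p * q = sliceLeft ε (H.T₁.symm (p ⊗ₜ q))) : H.IsAntipode S := by
  have mul'_rTensor : LinearMap.mul' ℂ A ∘ₗ S.toLinearMap.rTensor A
      = sliceLeft ε ∘ₗ H.T₁.symm.toLinearMap := TensorProduct.ext' fun p q => by simp [hS]
  have mul'_lTensor (z : A ⊗[ℂ] A) (c : A) :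
      LinearMap.mul' ℂ A (((sliceLeft ε ∘ₗ H.T₁.symm.toLinearMap) ∘ₗ
        (TensorProduct.mk ℂ A A).flip c).lTensor A z)
      = LinearMap.mul' ℂ A (S.toLinearMap.lTensor A z) * c := by
    induction z <;> simp_all [add_mul, ← hS, mul_assoc]
  refine ⟨ε, hε, fun a b => ?_, fun a b => H.nondegenerate.eq_of_mul_right fun c => ?_⟩
  · simpa using LinearMap.congr_fun mul'_rTensor (H.T₁ (a ⊗ₜ b))
  · have h := H.coassoc.apply a (H.T₁.symm (b ⊗ₜ c))
    rw [LinearEquiv.coe_coe, LinearEquiv.apply_symm_apply, TensorProduct.assoc_symm_tmul,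
      LinearMap.rTensor_tmul, LinearEquiv.coe_coe] at h
    rw [← mul'_lTensor, ← lTensor_assoc_tmul, ← h, ← LinearMap.lTensor_comp_apply,
      LinearMap.comp_assoc, LinearEquiv.symm_comp, LinearMap.comp_id,
      hε.mul'_lTensor_sliceLeft_T₂, hε.mul'_T₁_symm, mul_smul_comm, smul_mul_assoc]

end IsCounit

namespace IsAntipode

variable {H} {S : A ≃ₗ[ℂ] A} (hS : H.IsAntipode S)
include hS

theorem mul'_rTensor_T₁ {ε : A →ₗ[ℂ] ℂ} (hε : H.IsCounit ε) (z : A ⊗[ℂ] A) :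
    LinearMap.mul' ℂ A (S.toLinearMap.rTensor A (H.T₁ z)) = sliceLeft ε z := by
  obtain ⟨ε', hε', h, -⟩ := hS
  obtain rfl := hε.unique hε'
  induction z <;> simp_all

theorem apply_mul {ε : A →ₗ[ℂ] ℂ} (hε : H.IsCounit ε) (p q : A) :
    S p * q = sliceLeft ε (H.T₁.symm (p ⊗ₜ q)) := by
  simp [← hS.mul'_rTensor_T₁ hε]

theorem unique {S' : A ≃ₗ[ℂ] A} (hS' : H.IsAntipode S') : S = S' := by
  obtain ⟨ε, hε, -⟩ := id hS
  ext p
  exact H.nondegenerate.eq_of_mul_right fun q => by rw [hS.apply_mul hε, hS'.apply_mul hε]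

theorem mul'_rTensor_comul {ε : A →ₗ[ℂ] ℂ} (hε : H.IsCounit ε) (a : A) (z : A ⊗[ℂ] A) :
    LinearMap.mul' ℂ A (S.toLinearMap.rTensor A (left (H.comul a) z))
      = ε a • LinearMap.mul' ℂ A (S.toLinearMap.rTensor A z) := by
  obtain ⟨w, rfl⟩ := H.T₁.surjective z
  rw [left_comul_T₁, hS.mul'_rTensor_T₁ hε, hS.mul'_rTensor_T₁ hε]
  induction w <;> simp_all [hε.map_mul, smul_smul]

theorem mul'_rTensor_mulRight (p : A) (z : A ⊗[ℂ] A) :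
    LinearMap.mul' ℂ A (S.toLinearMap.rTensor A ((LinearMap.mulRight ℂ p).rTensor A z))
      = S p * LinearMap.mul' ℂ A (S.toLinearMap.rTensor A z) := by
  obtain ⟨ε, hε, -⟩ := id hS
  obtain ⟨w, rfl⟩ := H.T₁.surjective z
  induction w with
  | tmul a b =>
    rw [← left_comul_tmul, hS.mul'_rTensor_comul hε, hS.mul'_rTensor_T₁ hε]
    simp [mul_smul_comm]
  | _ => simp_all [mul_add]

theorem mul'_rTensor_T₃ {ε : A →ₗ[ℂ] ℂ} (hε : H.IsCounit ε) (a b : A) :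
    LinearMap.mul' ℂ A (S.toLinearMap.rTensor A (H.T₃ (a ⊗ₜ b))) = ε a • S b := by
  refine H.nondegenerate.eq_of_mul_right fun c => ?_
  have mul_right (z : A ⊗[ℂ] A) : LinearMap.mul' ℂ A (S.toLinearMap.rTensor A z) * c
      = LinearMap.mul' ℂ A (S.toLinearMap.rTensor A ((LinearMap.mulRight ℂ c).lTensor A z)) := by
    induction z <;> simp_all [add_mul, mul_assoc]
  rw [mul_right, ← rTensor_mulRight_T₁, hS.mul'_rTensor_mulRight, hS.mul'_rTensor_T₁ hε,
    sliceLeft_tmul, mul_smul_comm, smul_mul_assoc]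

theorem map_mul (p q : A) : S (p * q) = S q * S p :=
  H.nondegenerate.eq_of_mul_right fun r => by
    simpa [mul_assoc] using hS.mul'_rTensor_mulRight q (p ⊗ₜ r)

end IsAntipode

namespace IsLeftIntegral

variable {H} {φ : A →ₗ[ℂ] ℂ} (hφ : H.IsLeftIntegral φ)
include hφ

theorem isAntipode_antipode : H.IsAntipode H.antipode := by
  obtain ⟨ε, hε⟩ := H.exists_isCounit
  obtain ⟨S, -, hS⟩ := hφ.exists_antipode_formula hε
  exact Classical.epsilon_spec ⟨S, hε.isAntipode hS⟩

theorem antipode_sliceRight_T₁ (z : A ⊗[ℂ] A) :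
    H.antipode (sliceRight φ (H.T₁ z)) = sliceRight φ (H.T₄ z) := by
  obtain ⟨ε, hε⟩ := H.exists_isCounit
  obtain ⟨S, hS', hS⟩ := hφ.exists_antipode_formula hε
  rw [hφ.isAntipode_antipode.unique (hε.isAntipode hS), hS']

end IsLeftIntegral

end RegularMultiplierHopfAlgebra

namespace AlgebraicQuantumGroup

open RegularMultiplierHopfAlgebra

variable {A : Type*} [NonUnitalRing A] [Module ℂ A] [IsScalarTower ℂ A A] [SMulCommClass ℂ A A]
variable (G : AlgebraicQuantumGroup A)

theorem isAntipode_S : G.IsAntipode G.S := G.isLeftIntegral_φ.isAntipode_antipode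

theorem S_mul (a b : A) : G.S (a * b) = G.S b * G.S a := G.isAntipode_S.map_mul a b

theorem S_sliceRight_T₁ (z : A ⊗[ℂ] A) :
    G.S (sliceRight G.φ (G.T₁ z)) = sliceRight G.φ (G.T₄ z) :=
  G.isLeftIntegral_φ.antipode_sliceRight_T₁ z

theorem ψ_apply (a : A) : G.ψ a = G.φ (G.S a) := rfl

theorem ψ_ne_zero : G.ψ ≠ 0 := fun h => G.isLeftIntegral_φ.1 <| LinearMap.ext fun a => by
  simpa [ψ_apply] using LinearMap.congr_fun h (G.S.symm a)

/-! ### The antipode reverses the coproduct -/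

/-- The flipped square `σ(S ⊗ S)` of the antipode, `a ⊗ b ↦ S(b) ⊗ S(a)`. -/
def flipS : A ⊗[ℂ] A →ₗ[ℂ] A ⊗[ℂ] A :=
  (TensorProduct.comm ℂ A A).toLinearMap ∘ₗ TensorProduct.map G.S.toLinearMap G.S.toLinearMap

@[simp] theorem flipS_tmul (a b : A) : G.flipS (a ⊗ₜ b) = G.S b ⊗ₜ G.S a := rfl

theorem flipS_rTensor_mulLeft (t : A) (z : A ⊗[ℂ] A) :
    G.flipS ((LinearMap.mulLeft ℂ t).rTensor A z)
      = (LinearMap.mulRight ℂ (G.S t)).lTensor A (G.flipS z) := by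
  induction z <;> simp_all [S_mul]

theorem flipS_rTensor_mulRight (t : A) (z : A ⊗[ℂ] A) :
    G.flipS ((LinearMap.mulRight ℂ t).rTensor A z)
      = (LinearMap.mulLeft ℂ (G.S t)).lTensor A (G.flipS z) := by
  induction z <;> simp_all [S_mul]

theorem flipS_lTensor_mulLeft (t : A) (z : A ⊗[ℂ] A) :
    G.flipS ((LinearMap.mulLeft ℂ t).lTensor A z)
      = (LinearMap.mulRight ℂ (G.S t)).rTensor A (G.flipS z) := by
  induction z <;> simp_all [S_mul]

theorem flipS_lTensor_mulRight (t : A) (z : A ⊗[ℂ] A) :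
    G.flipS ((LinearMap.mulRight ℂ t).lTensor A z)
      = (LinearMap.mulLeft ℂ (G.S t)).rTensor A (G.flipS z) := by
  induction z <;> simp_all [S_mul]

theorem sliceRight_flipS (f : A →ₗ[ℂ] ℂ) (z : A ⊗[ℂ] A) :
    sliceRight f (G.flipS z) = G.S (sliceLeft (f ∘ₗ G.S.toLinearMap) z) := by
  induction z <;> simp_all

theorem sliceLeft_flipS (f : A →ₗ[ℂ] ℂ) (z : A ⊗[ℂ] A) :
    sliceLeft f (G.flipS z) = G.S (sliceRight (f ∘ₗ G.S.toLinearMap) z) := by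
  induction z <;> simp_all

/-- For `z = r ⊗ s`, both sides are `t p₁ ⊗ r f(p₂ s)`. -/
theorem rTensor_mulLeft_comm_lTensor (f : A →ₗ[ℂ] ℂ) (t p : A) (z : A ⊗[ℂ] A) :
    (LinearMap.mulLeft ℂ t).rTensor A (TensorProduct.comm ℂ A A
        ((sliceRight f ∘ₗ G.T₁.toLinearMap ∘ₗ TensorProduct.mk ℂ A A p).lTensor A z))
      = (sliceRightHom z ∘ₗ mulLeftFunctional f).lTensor A (G.T₂ (t ⊗ₜ p)) := by
  induction z with
  | tmul r s =>
    have slice_tmul : sliceRightHom (r ⊗ₜ[ℂ] s) ∘ₗ mulLeftFunctional f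
        = (f ∘ₗ LinearMap.mulRight ℂ s).smulRight r := by
      ext
      simp
    rw [slice_tmul, lTensor_smulRight, ← sliceRight_lTensor, ← rTensor_mulLeft_T₁,
      sliceRight_rTensor]
    rfl
  | _ => simp_all [LinearMap.add_comp, LinearMap.lTensor_add]

/-- `S(p₂) φ(p₃ q) = q₁ φ(p₂ q₂)`, the antipode formula applied to the second leg of `Δ(p)`. -/
theorem lTensor_S_T₁ (p q b : A) :
    G.S.toLinearMap.lTensor A (G.T₁ (G.sliceT₁ G.φ q p ⊗ₜ b))
      = TensorProduct.comm ℂ A A ((sliceRight G.φ ∘ₗ G.T₁.toLinearMap ∘ₗ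
          TensorProduct.mk ℂ A A p).lTensor A (G.T₂ (G.S b ⊗ₜ q))) := by
  refine G.nondegenerate.eq_of_rTensor_mulLeft fun t => ?_
  rw [rTensor_mulLeft_comm_lTensor, rTensor_lTensor_comm, rTensor_mulLeft_T₁, T₂_sliceT₁,
    ← LinearMap.lTensor_comp_apply, ← LinearMap.lTensor_comp_apply]
  congr 2
  ext p'
  calc G.S (G.sliceT₁ G.φ q p' * b)
      = LinearMap.mulLeft ℂ (G.S b) (sliceRight G.φ (G.T₄ (p' ⊗ₜ q))) := by
        simp [S_mul, S_sliceRight_T₁]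
    _ = sliceRight (mulLeftFunctional G.φ p') (G.T₂ (G.S b ⊗ₜ q)) := by
        rw [← sliceRight_rTensor, ← lTensor_mulLeft_T₂, sliceRight_lTensor]
        rfl

theorem flipS_T₁ (a b : A) : G.flipS (G.T₁ (a ⊗ₜ b)) = G.T₂ (G.S b ⊗ₜ G.S a) := by
  obtain ⟨z, rfl⟩ :=
    ((sliceRight_surjective (V := A) G.isLeftIntegral_φ.1).comp G.T₁.surjective) a
  simp only [Function.comp_apply]
  induction z with
  | tmul p q =>
    have S_comp_slice : G.S.toLinearMap ∘ₗ sliceRight G.φ ∘ₗ G.T₁.toLinearMap ∘ₗ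
        TensorProduct.mk ℂ A A p = G.sliceT₄ G.φ p := by
      ext s
      simp [S_sliceRight_T₁]
    calc G.flipS (G.T₁ (sliceRight G.φ (G.T₁ (p ⊗ₜ q)) ⊗ₜ b))
        = TensorProduct.comm ℂ A A (G.S.toLinearMap.rTensor A
            (G.S.toLinearMap.lTensor A (G.T₁ (G.sliceT₁ G.φ q p ⊗ₜ b)))) := by
          rw [← LinearMap.comp_apply (f := LinearMap.rTensor _ _),
            LinearMap.rTensor_comp_lTensor]
          rfl
      _ = (G.sliceT₄ G.φ p).lTensor A (G.T₂ (G.S b ⊗ₜ q)) := by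
          rw [lTensor_S_T₁, LinearMap.rTensor_comm, TensorProduct.comm_comm,
            ← LinearMap.lTensor_comp_apply, S_comp_slice]
      _ = G.T₂ (G.S b ⊗ₜ G.S (sliceRight G.φ (G.T₁ (p ⊗ₜ q)))) := by
          rw [S_sliceRight_T₁, ← T₂_sliceT₄, sliceT₄_apply]
  | _ => simp_all [TensorProduct.add_tmul, TensorProduct.tmul_add]

theorem flipS_T₂ (b a : A) : G.flipS (G.T₂ (b ⊗ₜ a)) = G.T₁ (G.S a ⊗ₜ G.S b) := by
  refine G.nondegenerate.eq_of_rTensor_mulLeft <| G.S.surjective.forall.2 fun t => ?_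
  rw [← flipS_lTensor_mulRight, ← rTensor_mulLeft_T₁, flipS_rTensor_mulLeft, flipS_T₁,
    ← rTensor_mulLeft_T₁]

theorem flipS_T₄ (b a : A) : G.flipS (G.T₄ (b ⊗ₜ a)) = G.T₃ (G.S a ⊗ₜ G.S b) := by
  refine G.nondegenerate.eq_of_lTensor_mulRight <| G.S.surjective.forall.2 fun t => ?_
  rw [← flipS_rTensor_mulLeft, ← lTensor_mulLeft_T₂, flipS_lTensor_mulLeft, flipS_T₂,
    ← rTensor_mulRight_T₁]

theorem flipS_T₃ (a b : A) : G.flipS (G.T₃ (a ⊗ₜ b)) = G.T₄ (G.S b ⊗ₜ G.S a) := by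
  refine G.nondegenerate.eq_of_lTensor_mulRight <| G.S.surjective.forall.2 fun t => ?_
  rw [← flipS_rTensor_mulLeft, rTensor_mulLeft_T₃, flipS_rTensor_mulRight, flipS_T₂,
    lTensor_mulLeft_T₁]

end AlgebraicQuantumGroup

/-! ### Integrals -/

namespace RegularMultiplierHopfAlgebra

open AlgebraicQuantumGroup

variable {A : Type*} [NonUnitalRing A] [Module ℂ A] [IsScalarTower ℂ A A] [SMulCommClass ℂ A A]
variable {H : RegularMultiplierHopfAlgebra A} {φ ψ : A →ₗ[ℂ] ℂ}

theorem IsLeftIntegral.apply_mul_sliceRight (hφ : H.IsLeftIntegral φ) (θ : A →ₗ[ℂ] ℂ) (a : A)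
    (z : A ⊗[ℂ] A) : φ (a * sliceRight θ z) = θ (sliceRight φ (left (H.comul a) (H.T₃ z))) := by
  rw [left_comul_T₃]
  induction z <;> simp_all [mul_add, hφ.2.1, mul_smul_comm, mul_comm]

theorem IsRightIntegral.apply_mul_sliceRight (hψ : H.IsRightIntegral ψ) (θ : A →ₗ[ℂ] ℂ) (a : A)
    (z : A ⊗[ℂ] A) : ψ (a * sliceRight θ z) = θ (sliceLeft ψ (left (H.comul a) (H.T₁ z))) := by
  rw [left_comul_T₁]
  induction z <;> simp_all [mul_add, hψ.2.1, mul_smul_comm, mul_comm]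

theorem IsLeftIntegral.apply_sliceLeft_mul (hφ : H.IsLeftIntegral φ) (θ : A →ₗ[ℂ] ℂ) (a : A)
    (z : A ⊗[ℂ] A) : φ (sliceLeft θ z * a) = θ (sliceRight φ (right (H.comul a) (H.T₂ z))) := by
  rw [right_comul_T₂]
  induction z <;> simp_all [add_mul, hφ.2.2, smul_mul_assoc, mul_comm]

theorem IsRightIntegral.apply_sliceLeft_mul (hψ : H.IsRightIntegral ψ) (θ : A →ₗ[ℂ] ℂ) (a : A)
    (z : A ⊗[ℂ] A) : ψ (sliceLeft θ z * a) = θ (sliceLeft ψ (right (H.comul a) (H.T₄ z))) := by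
  rw [right_comul_T₄]
  induction z <;> simp_all [add_mul, hψ.2.2, smul_mul_assoc, mul_comm]

theorem IsRightIntegral.range_mulRightFunctional (hψ : H.IsRightIntegral ψ)
    (hφ : H.IsLeftIntegral φ) :
    LinearMap.range (mulRightFunctional ψ) = LinearMap.range (mulRightFunctional φ) :=
  range_eq_of_comp_eq_comp (s := sliceRight φ ∘ₗ H.T₁.symm.toLinearMap)
    (t := sliceRight ψ ∘ₗ H.T₃.symm.toLinearMap)
    ((sliceRight_surjective hφ.1).comp H.T₁.symm.surjective)
    ((sliceRight_surjective hψ.1).comp H.T₃.symm.surjective)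
    (LinearMap.ext fun z => LinearMap.ext fun a => by
      simp [hψ.apply_mul_sliceRight, hφ.apply_mul_sliceRight, apply_sliceRight])

theorem IsRightIntegral.range_mulLeftFunctional (hψ : H.IsRightIntegral ψ)
    (hφ : H.IsLeftIntegral φ) :
    LinearMap.range (mulLeftFunctional ψ) = LinearMap.range (mulLeftFunctional φ) :=
  range_eq_of_comp_eq_comp (s := sliceLeft φ ∘ₗ H.T₄.symm.toLinearMap)
    (t := sliceLeft ψ ∘ₗ H.T₂.symm.toLinearMap)
    ((sliceLeft_surjective hφ.1).comp H.T₄.symm.surjective)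
    ((sliceLeft_surjective hψ.1).comp H.T₂.symm.surjective)
    (LinearMap.ext fun z => LinearMap.ext fun a => by
      simp [hψ.apply_sliceLeft_mul, hφ.apply_sliceLeft_mul, apply_sliceRight])

end RegularMultiplierHopfAlgebra

namespace AlgebraicQuantumGroup

open RegularMultiplierHopfAlgebra

variable {A : Type*} [NonUnitalRing A] [Module ℂ A] [IsScalarTower ℂ A A] [SMulCommClass ℂ A A]
variable (G : AlgebraicQuantumGroup A)

theorem isRightIntegral_ψ : G.IsRightIntegral G.ψ := by
  refine ⟨G.ψ_ne_zero, fun a b => G.S.injective ?_, fun a b => G.S.injective ?_⟩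
  · have h := congrArg (sliceRight G.φ) (G.flipS_T₁ a b)
    rwa [sliceRight_flipS, G.isLeftIntegral_φ.2.2, ← ψ_apply, ← map_smul] at h
  · have h := congrArg (sliceRight G.φ) (G.flipS_T₄ b a)
    rwa [sliceRight_flipS, G.isLeftIntegral_φ.2.1, ← ψ_apply, ← map_smul] at h

theorem S_sliceLeft_T₂ (x c : A) :
    G.S (sliceLeft G.ψ (G.T₂ (x ⊗ₜ c))) = sliceLeft G.ψ (G.T₃ (x ⊗ₜ c)) := by
  apply G.S.injective
  have h := G.S_sliceRight_T₁ (G.S c ⊗ₜ G.S x)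
  rwa [← flipS_T₂, ← flipS_T₃, sliceRight_flipS, sliceRight_flipS] at h

theorem lTensor_mulRightFunctional_T₃ {n : A} (hn : mulRightFunctional G.φ n = 0) (x : A) :
    (mulRightFunctional G.φ).lTensor A (G.T₃ (n ⊗ₜ x)) = 0 := by
  have slice_T₁ (y : A) : sliceRight G.φ (G.T₁ (y ⊗ₜ n)) = 0 := by
    refine G.nondegenerate.2 _ fun t => ?_
    have functional_eq_zero : G.φ ∘ₗ LinearMap.mulRight ℂ n = 0 := hn
    rw [← LinearMap.mulLeft_apply (R := ℂ), ← sliceRight_rTensor, rTensor_mulLeft_T₁,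
      sliceRight_lTensor, functional_eq_zero, ← sliceRightHom_apply, map_zero]
  have slice_T₄ (y : A) : sliceRight G.φ (G.T₄ (y ⊗ₜ n)) = 0 :=
    (G.isLeftIntegral_φ.sliceRight_T₁_eq_zero_iff _).1 (slice_T₁ y)
  refine eq_zero_of_sliceLeft _ fun ω => LinearMap.ext fun y => ?_
  rw [sliceLeft_lTensor, mulRightFunctional_apply, ← LinearMap.mulLeft_apply (R := ℂ),
    ← sliceLeft_lTensor, lTensor_mulLeft_T₃, ← apply_sliceRight, sliceRight_rTensor, slice_T₄]
  simp

theorem counit_eq_zero {ε : A →ₗ[ℂ] ℂ} (hε : G.IsCounit ε) {n : A}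
    (hn : mulRightFunctional G.φ n = 0) : ε n = 0 := by
  by_contra hne
  have φ_mul (y x : A) : G.φ (y * x) = 0 := by
    obtain ⟨x, rfl⟩ := G.S.surjective x
    have φ_mul' (z : A ⊗[ℂ] A) :
        G.φ (y * LinearMap.mul' ℂ A (G.S.toLinearMap.rTensor A z))
          = TensorProduct.lift (LinearMap.applyₗ ∘ₗ LinearMap.mulLeft ℂ y ∘ₗ G.S.toLinearMap)
            ((mulRightFunctional G.φ).lTensor A z) := by
      induction z <;> simp_all [mul_add, mul_assoc]
    have h := φ_mul' (G.T₃ (n ⊗ₜ x))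
    rw [G.lTensor_mulRightFunctional_T₃ hn, G.isAntipode_S.mul'_rTensor_T₃ hε, map_zero,
      mul_smul_comm, map_smul] at h
    exact (smul_eq_zero.1 h).resolve_left hne
  refine G.isLeftIntegral_φ.1 (LinearMap.ext (hε.mul'_surjective.forall.2 fun z => ?_))
  induction z <;> simp_all

/-- Faithfulness of `φ`: the null space of `φ` is stable under slices of the coproduct and the
counit vanishes on it. -/
theorem mulRightFunctional_φ_injective : Function.Injective (mulRightFunctional G.φ) := by
  refine (injective_iff_map_eq_zero _).2 fun n hn => G.nondegenerate.1 _ fun x => ?_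
  obtain ⟨ε, hε⟩ := G.exists_isCounit
  rw [← hε.sliceRight_T₃]
  refine (Module.forall_dual_apply_eq_zero_iff ℂ _).1 fun ω => ?_
  rw [apply_sliceRight]
  refine G.counit_eq_zero hε ?_
  rw [← sliceLeft_lTensor, G.lTensor_mulRightFunctional_T₃ hn, map_zero]

theorem φ_mul_eq_ψ_mul (c d x : A) :
    G.φ (sliceLeft (G.ψ ∘ₗ G.S.toLinearMap) (G.T₂ (c ⊗ₜ G.S d)) * x)
      = G.ψ (x * sliceRight G.ψ (G.T₁ (G.S c ⊗ₜ d))) := by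
  calc G.φ (sliceLeft (G.ψ ∘ₗ G.S.toLinearMap) (G.T₂ (c ⊗ₜ G.S d)) * x)
      = G.ψ (G.S (c * sliceRight G.φ (G.T₁ (G.S d ⊗ₜ x)))) := by
        rw [← LinearMap.mulRight_apply (R := ℂ), ← LinearMap.mulLeft_apply (R := ℂ),
          ← sliceLeft_lTensor, ← sliceRight_rTensor, rTensor_mulLeft_T₁, ← apply_sliceRight]
        rfl
    _ = G.φ (G.S d * sliceLeft G.ψ (G.T₃ (x ⊗ₜ G.S c))) := by
        rw [S_mul, S_sliceRight_T₁, ← LinearMap.mulRight_apply (R := ℂ),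
          ← LinearMap.mulLeft_apply (R := ℂ), ← sliceLeft_lTensor, ← sliceRight_rTensor,
          lTensor_mulLeft_T₃, apply_sliceRight]
    _ = G.ψ (x * sliceRight G.ψ (G.T₁ (G.S c ⊗ₜ d))) := by
        rw [← S_sliceLeft_T₂, ← S_mul, ← ψ_apply, ← LinearMap.mulRight_apply (R := ℂ),
          ← LinearMap.mulLeft_apply (R := ℂ), ← sliceLeft_lTensor, ← sliceRight_rTensor,
          rTensor_mulLeft_T₁, apply_sliceRight]

theorem range_mulRightFunctional_ψ :
    LinearMap.range (mulRightFunctional G.ψ) = G.dualSubmodule :=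
  G.isRightIntegral_ψ.range_mulRightFunctional G.isLeftIntegral_φ

theorem range_mulLeftFunctional_φ :
    LinearMap.range (mulLeftFunctional G.φ) = G.dualSubmodule := by
  have ψ_comp_S_ne_zero : G.ψ ∘ₗ G.S.toLinearMap ≠ 0 := fun h =>
    G.ψ_ne_zero <| LinearMap.ext <| G.S.surjective.forall.2 <| LinearMap.congr_fun h
  rw [← range_mulRightFunctional_ψ]
  exact range_eq_of_comp_eq_comp
    (s := sliceLeft (G.ψ ∘ₗ G.S.toLinearMap) ∘ₗ G.T₂.toLinearMap ∘ₗ G.S.toLinearMap.lTensor A)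
    (t := sliceRight G.ψ ∘ₗ G.T₁.toLinearMap ∘ₗ G.S.toLinearMap.rTensor A)
    ((sliceLeft_surjective ψ_comp_S_ne_zero).comp
      (G.T₂.surjective.comp (LinearMap.lTensor_surjective _ G.S.surjective)))
    ((sliceRight_surjective G.ψ_ne_zero).comp
      (G.T₁.surjective.comp (LinearMap.rTensor_surjective _ G.S.surjective)))
    (TensorProduct.ext' fun c d => LinearMap.ext fun x => G.φ_mul_eq_ψ_mul c d x)

theorem range_mulLeftFunctional_ψ :
    LinearMap.range (mulLeftFunctional G.ψ) = G.dualSubmodule :=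
  (G.isRightIntegral_ψ.range_mulLeftFunctional G.isLeftIntegral_φ).trans
    G.range_mulLeftFunctional_φ

theorem isDualAntipode_dualS : G.IsDualAntipode G.dualS := by
  have dualMap_comp : G.S.dualMap.toLinearMap ∘ₗ mulRightFunctional G.φ
      = mulLeftFunctional G.ψ ∘ₗ G.S.symm.toLinearMap := by
    ext c x
    simp [ψ_apply, S_mul]
  have map_dualSubmodule : G.dualSubmodule.map G.S.dualMap.toLinearMap = G.dualSubmodule := by
    rw [dualSubmodule, ← LinearMap.range_comp, dualMap_comp,
      LinearMap.range_comp_of_range_eq_top _ (LinearEquiv.range _), range_mulLeftFunctional_ψ,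
      dualSubmodule]
  exact Classical.epsilon_spec (p := G.IsDualAntipode)
    ⟨G.S.dualMap.ofSubmodules G.dualSubmodule G.dualSubmodule map_dualSubmodule,
      fun _ _ => rfl⟩

/-! ### Actions of the dual -/

/-- The identification of `A` with its dual given by `c ↦ φ(· c)`. -/
def dualEquiv : A ≃ₗ[ℂ] G.Dual := LinearEquiv.ofInjective _ G.mulRightFunctional_φ_injective

/-- The map `c ↦ φ(c ·)` into the dual. -/
def leftDual : A →ₗ[ℂ] G.Dual :=
  (mulLeftFunctional G.φ).codRestrict G.dualSubmodule fun c =>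
    G.range_mulLeftFunctional_φ ▸ LinearMap.mem_range_self _ c

/-- The map `c ↦ ψ(· c)` into the dual. -/
def rightDual : A →ₗ[ℂ] G.Dual :=
  (mulRightFunctional G.ψ).codRestrict G.dualSubmodule fun c =>
    G.range_mulRightFunctional_ψ ▸ LinearMap.mem_range_self _ c

@[simp] theorem toFunctional_dualEquiv (c x : A) :
    G.toFunctional (G.dualEquiv c) x = G.φ (x * c) := rfl

@[simp] theorem toFunctional_leftDual (c x : A) : G.toFunctional (G.leftDual c) x = G.φ (c * x) :=
  rfl

@[simp] theorem toFunctional_rightDual (c x : A) :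
    G.toFunctional (G.rightDual c) x = G.ψ (x * c) := rfl

theorem leftDual_surjective : Function.Surjective G.leftDual := fun b => by
  obtain ⟨c, hc⟩ : G.toFunctional b ∈ LinearMap.range (mulLeftFunctional G.φ) :=
    G.range_mulLeftFunctional_φ ▸ b.2
  exact ⟨c, G.toFunctional_injective hc⟩

theorem rightDual_surjective : Function.Surjective G.rightDual := fun b => by
  obtain ⟨c, hc⟩ : G.toFunctional b ∈ LinearMap.range (mulRightFunctional G.ψ) :=
    G.range_mulRightFunctional_ψ ▸ b.2
  exact ⟨c, G.toFunctional_injective hc⟩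

theorem eq_of_toFunctional {x y : A} (h : ∀ b, G.toFunctional b x = G.toFunctional b y) :
    x = y := by
  refine G.mulRightFunctional_φ_injective (LinearMap.ext fun c => ?_)
  exact h (G.leftDual c)

theorem toFunctional_dualS (a : A) (b : G.Dual) :
    G.toFunctional (G.dualS b) a = G.toFunctional b (G.S a) := G.isDualAntipode_dualS a b

theorem act_mul_right (b : G.Dual) (a t : A) :
    G.act b a * t = sliceRight (G.toFunctional b) (G.T₃ (a ⊗ₜ t)) := by
  refine G.eq_of_mul_left fun r => ?_
  rw [← mul_assoc, mul_act, ← LinearMap.mulLeft_apply (R := ℂ) r, ← sliceRight_rTensor,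
    rTensor_mulLeft_T₃, sliceRight_rTensor, LinearMap.mulRight_apply]

theorem act_leftDual (c a : A) : G.act (G.leftDual c) a = sliceRight G.φ (G.T₄ (c ⊗ₜ a)) := by
  refine G.eq_of_mul_left fun r => ?_
  rw [mul_act, ← LinearMap.mulLeft_apply (R := ℂ) r, ← sliceRight_rTensor, ← lTensor_mulLeft_T₂,
    sliceRight_lTensor]
  rfl

/-- The left action `(b, a) ↦ b ▷ a` as a bilinear map. -/
def actHom : G.Dual →ₗ[ℂ] A →ₗ[ℂ] A :=
  LinearMap.mk₂ ℂ (fun b a => G.act b a) G.act_add G.act_smul (fun b => map_add (G.act b))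
    fun r b => map_smul (G.act b) r

@[simp] theorem actHom_apply (b : G.Dual) (a : A) : G.actHom b a = G.act b a := rfl

/-- The right action `(b, a) ↦ a ◁ b = (b ⊗ ι)Δ(a)`, that is `(φ ⊗ ι)(Δ(a)(c ⊗ 1))` for
`b = φ(· c)`. -/
def ract : G.Dual →ₗ[ℂ] A →ₗ[ℂ] A :=
  ((TensorProduct.mk ℂ A A).flip ∘ₗ G.dualEquiv.symm.toLinearMap).compr₂
    (sliceLeft G.φ ∘ₗ G.T₃.toLinearMap)

theorem ract_dualEquiv (c a : A) : G.ract (G.dualEquiv c) a = sliceLeft G.φ (G.T₃ (a ⊗ₜ c)) := by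
  simp [ract]

theorem ract_mul_right (b : G.Dual) (a t : A) :
    G.ract b a * t = sliceLeft (G.toFunctional b) (G.T₁ (a ⊗ₜ t)) := by
  obtain ⟨c, rfl⟩ := G.dualEquiv.surjective b
  rw [ract_dualEquiv, ← LinearMap.mulRight_apply (R := ℂ) t, ← sliceLeft_lTensor,
    ← rTensor_mulRight_T₁, sliceLeft_rTensor]
  rfl

theorem ract_rightDual (c a : A) :
    G.ract (G.rightDual c) a = sliceLeft G.ψ (G.T₃ (a ⊗ₜ c)) := by
  refine G.nondegenerate.eq_of_mul_right fun t => ?_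
  rw [ract_mul_right, ← LinearMap.mulRight_apply (R := ℂ) t, ← sliceLeft_lTensor,
    ← rTensor_mulRight_T₁, sliceLeft_rTensor]
  rfl

theorem toFunctional_act (b b' : G.Dual) (a : A) :
    G.toFunctional b (G.act b' a) = G.toFunctional b' (G.ract b a) := by
  obtain ⟨c, rfl⟩ := G.dualEquiv.surjective b
  rw [toFunctional_dualEquiv, act_mul_right, apply_sliceRight, ract_dualEquiv]

theorem ract_act (b b' : G.Dual) (a : A) :
    G.ract b (G.act b' a) = G.act b' (G.ract b a) :=
  G.eq_of_toFunctional fun c => by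
    rw [← toFunctional_act, ← act_mul, toFunctional_act, toFunctional_mul]

theorem ract_mul (b b' : G.Dual) (a : A) : G.ract (b * b') a = G.ract b' (G.ract b a) :=
  G.eq_of_toFunctional fun c => by
    rw [← toFunctional_act, toFunctional_mul, toFunctional_act, ract_act, toFunctional_act]

theorem toFunctional_dualS_eq_comp (b : G.Dual) :
    G.toFunctional (G.dualS b) = G.toFunctional b ∘ₗ G.S.toLinearMap :=
  LinearMap.ext fun a => G.toFunctional_dualS a b

theorem S_act (b : G.Dual) (a : A) : G.S (G.act (G.dualS b) a) = G.ract b (G.S a) :=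
  G.nondegenerate.eq_of_mul_right <| G.S.surjective.forall.2 fun t => by
    rw [← S_mul, mul_act, ract_mul_right, ← flipS_T₂, sliceLeft_flipS, toFunctional_dualS_eq_comp]

theorem S_ract (b : G.Dual) (a : A) : G.S (G.ract (G.dualS b) a) = G.act b (G.S a) :=
  G.eq_of_mul_left <| G.S.surjective.forall.2 fun t => by
    rw [← S_mul, mul_act, ract_mul_right, ← flipS_T₁, sliceRight_flipS, toFunctional_dualS_eq_comp]

theorem nondegenerate_dual : NondegenerateProduct G.Dual := by
  refine ⟨fun b hb => G.dual_ext ?_, fun b hb => G.dual_ext ?_⟩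
  · refine ((sliceRight_surjective G.isLeftIntegral_φ.1).comp G.T₄.surjective).forall.2 fun z => ?_
    induction z with
    | tmul c d =>
      rw [Function.comp_apply, ← act_leftDual, ← toFunctional_mul, hb]
      simp
    | _ => simp_all
  · refine ((sliceLeft_surjective G.ψ_ne_zero).comp G.T₃.surjective).forall.2 fun z => ?_
    induction z with
    | tmul d c =>
      rw [Function.comp_apply, ← ract_rightDual, ← toFunctional_act, ← toFunctional_mul, hb]
      simp
    | _ => simp_all

/-- The translate `b(· a)` of `b`, bilinear in `a` and `b`: the left action of `A` on its dual. -/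
def translateRight : A →ₗ[ℂ] G.Dual →ₗ[ℂ] G.Dual :=
  LinearMap.mk₂ ℂ
    (fun a b => ⟨mulRightFunctional (G.toFunctional b) a, by
      obtain ⟨c, rfl⟩ := G.dualEquiv.surjective b
      exact ⟨a * c, by ext; simp [mul_assoc]⟩⟩)
    (fun _ _ b => G.dual_ext fun x =>
      (congrArg (G.toFunctional b) (mul_add x _ _)).trans (map_add _ _ _))
    (fun r a b => G.dual_ext fun x =>
      (congrArg (G.toFunctional b) (mul_smul_comm r x a)).trans (map_smul _ _ _))
    (fun _ _ _ => rfl) (fun _ _ _ => rfl)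

/-- The translate `b(a ·)` of `b`, bilinear in `a` and `b`: the right action of `A` on its dual. -/
def translateLeft : A →ₗ[ℂ] G.Dual →ₗ[ℂ] G.Dual :=
  LinearMap.mk₂ ℂ
    (fun a b => ⟨mulLeftFunctional (G.toFunctional b) a, by
      obtain ⟨c, rfl⟩ := G.leftDual_surjective b
      rw [← range_mulLeftFunctional_φ]
      exact ⟨c * a, by ext; simp [mul_assoc]⟩⟩)
    (fun _ _ b => G.dual_ext fun x =>
      (congrArg (G.toFunctional b) (add_mul _ _ x)).trans (map_add _ _ _))
    (fun r a b => G.dual_ext fun x =>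
      (congrArg (G.toFunctional b) (smul_mul_assoc r a x)).trans (map_smul _ _ _))
    (fun _ _ _ => rfl) (fun _ _ _ => rfl)

@[simp] theorem toFunctional_translateRight (a x : A) (b : G.Dual) :
    G.toFunctional (G.translateRight a b) x = G.toFunctional b (x * a) := rfl

@[simp] theorem toFunctional_translateLeft (a x : A) (b : G.Dual) :
    G.toFunctional (G.translateLeft a b) x = G.toFunctional b (a * x) := rfl

/-! ### The pairing of `B ⊗ A` with `A ⊗ B` -/

/-- The slice `b ⊗ x ↦ ⟨a, b⟩ x` of `B ⊗ A` at `a`. -/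
def evalFst (a : A) : G.Dual ⊗[ℂ] A →ₗ[ℂ] A := sliceLeft (G.toFunctional.flip a)

@[simp] theorem evalFst_tmul (a x : A) (b : G.Dual) :
    G.evalFst a (b ⊗ₜ x) = G.toFunctional b a • x := by simp [evalFst]

theorem eq_of_evalFst {x x' : G.Dual ⊗[ℂ] A} (h : ∀ a, G.evalFst a x = G.evalFst a x') :
    x = x' :=
  eq_of_rTensor G.toFunctional.flip (fun b hb => G.dual_ext fun a => by simpa using hb a)
    fun a => (TensorProduct.lid ℂ A).injective (h a)

theorem evalFst_mul_tmul (a a' : A) (b : G.Dual) (x : G.Dual ⊗[ℂ] A) :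
    G.evalFst a' (x * b ⊗ₜ a) = G.evalFst (G.act b a') x * a := by
  induction x <;> simp_all [add_mul, toFunctional_mul, smul_mul_assoc]

theorem evalFst_tmul_mul (a a' : A) (b : G.Dual) (x : G.Dual ⊗[ℂ] A) :
    G.evalFst a' (b ⊗ₜ a * x) = a * G.evalFst (G.ract b a') x := by
  induction x <;> simp_all [mul_add, toFunctional_mul, toFunctional_act, mul_smul_comm]

theorem evalFst_lTensor (f : A →ₗ[ℂ] A) (a : A) (x : G.Dual ⊗[ℂ] A) :
    G.evalFst a (f.lTensor G.Dual x) = f (G.evalFst a x) := sliceLeft_lTensor f _ x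

theorem evalFst_rTensor_dualS (a : A) (x : G.Dual ⊗[ℂ] A) :
    G.evalFst a (G.dualS.toLinearMap.rTensor A x) = G.evalFst (G.S a) x := by
  induction x <;> simp_all [toFunctional_dualS]

theorem evalFst_rTensor_mulLeft (a : A) (b : G.Dual) (x : G.Dual ⊗[ℂ] A) :
    G.evalFst a ((LinearMap.mulLeft ℂ b).rTensor A x) = G.evalFst (G.ract b a) x := by
  induction x <;> simp_all [toFunctional_mul, toFunctional_act]

theorem evalFst_rTensor_mulRight (a : A) (b : G.Dual) (x : G.Dual ⊗[ℂ] A) :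
    G.evalFst a ((LinearMap.mulRight ℂ b).rTensor A x) = G.evalFst (G.act b a) x := by
  induction x <;> simp_all [toFunctional_mul]

theorem tensorPairing_tmul_right (x : G.Dual ⊗[ℂ] A) (a : A) (b : G.Dual) :
    G.tensorPairing x (a ⊗ₜ b) = G.toFunctional b (G.evalFst a x) := by
  induction x <;> simp_all [tensorPairing_tmul, pair]

theorem tensorPairing_tmul_left (b : G.Dual) (a : A) (y : A ⊗[ℂ] G.Dual) :
    G.tensorPairing (b ⊗ₜ a) y = G.toFunctional b (sliceRight (G.toFunctional.flip a) y) := by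
  induction y <;> simp_all [tensorPairing_tmul, pair, mul_comm]

theorem eq_of_tensorPairing {y z : A ⊗[ℂ] G.Dual}
    (h : ∀ x, G.tensorPairing x y = G.tensorPairing x z) : y = z :=
  eq_of_lTensor G.toFunctional.flip (fun b hb => G.dual_ext fun a => by simpa using hb a)
    fun a => (TensorProduct.rid ℂ A).injective <| G.eq_of_toFunctional fun b =>
      (G.tensorPairing_tmul_left b a y).symm.trans <|
        (h (b ⊗ₜ a)).trans (G.tensorPairing_tmul_left b a z)

/-- The action `x ▷ y` of `B ⊗ A` on `A ⊗ B`: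
`(b ⊗ a) ▷ (a' ⊗ b') = (b ▷ a') ⊗ b'(· a)`. -/
def leftAction : G.Dual ⊗[ℂ] A →ₗ[ℂ] A ⊗[ℂ] G.Dual →ₗ[ℂ] A ⊗[ℂ] G.Dual :=
  TensorProduct.map₂ G.actHom G.translateRight

/-- The action `y ◁ x` of `B ⊗ A` on `A ⊗ B`:
`(a' ⊗ b') ◁ (b ⊗ a) = (a' ◁ b) ⊗ b'(a ·)`. -/
def rightAction : G.Dual ⊗[ℂ] A →ₗ[ℂ] A ⊗[ℂ] G.Dual →ₗ[ℂ] A ⊗[ℂ] G.Dual :=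
  TensorProduct.map₂ G.ract G.translateLeft

@[simp] theorem leftAction_tmul (a a' : A) (b b' : G.Dual) :
    G.leftAction (b ⊗ₜ a) (a' ⊗ₜ b') = G.act b a' ⊗ₜ G.translateRight a b' := by
  simp [leftAction]

@[simp] theorem rightAction_tmul (a a' : A) (b b' : G.Dual) :
    G.rightAction (b ⊗ₜ a) (a' ⊗ₜ b') = G.ract b a' ⊗ₜ G.translateLeft a b' := by
  simp [rightAction]

theorem tensorPairing_leftAction (x x' : G.Dual ⊗[ℂ] A) (y : A ⊗[ℂ] G.Dual) :
    G.tensorPairing x' (G.leftAction x y) = G.tensorPairing (x' * x) y := by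
  induction x with
  | tmul b a =>
    induction y with
    | tmul a' b' => simp [tensorPairing_tmul_right, evalFst_mul_tmul]
    | _ => simp_all
  | _ => simp_all [mul_add]

theorem tensorPairing_rightAction (x x' : G.Dual ⊗[ℂ] A) (y : A ⊗[ℂ] G.Dual) :
    G.tensorPairing x' (G.rightAction x y) = G.tensorPairing (x * x') y := by
  induction x with
  | tmul b a =>
    induction y with
    | tmul a' b' => simp [tensorPairing_tmul_right, evalFst_tmul_mul]
    | _ => simp_all
  | _ => simp_all [add_mul]

theorem isExtendedPairing_iff (m : MultiplierAlgebra (G.Dual ⊗[ℂ] A))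
    (f : A ⊗[ℂ] G.Dual →ₗ[ℂ] ℂ) :
    IsExtendedPairing G.tensorPairing m f ↔
      (∀ x y, f (G.leftAction x y) = G.tensorPairing (left m x) y) ∧
      (∀ x y, f (G.rightAction x y) = G.tensorPairing (right m x) y) := by
  refine and_congr (forall₂_congr fun x y => ?_) (forall₂_congr fun x y => ?_)
  · refine ⟨fun h => h _ fun x' => G.tensorPairing_leftAction x x' y, fun h y' hy' => ?_⟩
    rw [G.eq_of_tensorPairing fun x' => (hy' x').trans (G.tensorPairing_leftAction x x' y).symm, h]
  · refine ⟨fun h => h _ fun x' => G.tensorPairing_rightAction x x' y, fun h y' hy' => ?_⟩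
    rw [G.eq_of_tensorPairing fun x' => (hy' x').trans (G.tensorPairing_rightAction x x' y).symm, h]

/-! ### Multipliers with prescribed slices -/

/-- `m` is the multiplier of `B ⊗ A` given by `θ : A → A`, regarded as an element of the completed
tensor product through `B ⊆ A'`: slicing it at `a'` gives `θ(a')`. Hence slicing `m(b ⊗ a)` at `a'`
gives `θ(b ▷ a')a`, and slicing `(b ⊗ a)m` gives `aθ(a' ◁ b)`. -/
structure HasSlices (θ : A →ₗ[ℂ] A) (m : MultiplierAlgebra (G.Dual ⊗[ℂ] A)) : Prop where
  evalFst_left : ∀ b a a', G.evalFst a' (left m (b ⊗ₜ a)) = θ (G.act b a') * a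
  evalFst_right : ∀ b a a', G.evalFst a' (right m (b ⊗ₜ a)) = a * θ (G.ract b a')

variable {G} {θ : A →ₗ[ℂ] A} {m n : MultiplierAlgebra (G.Dual ⊗[ℂ] A)}

theorem HasSlices.unique (hm : G.HasSlices θ m) (hn : G.HasSlices θ n) : m = n :=
  MultiplierAlgebra.ext_tmul
    (fun b a => G.eq_of_evalFst fun a' => by rw [hm.evalFst_left, hn.evalFst_left])
    (fun b a => G.eq_of_evalFst fun a' => by rw [hm.evalFst_right, hn.evalFst_right])

theorem isExtendedPairing_evaluation_iff :
    IsExtendedPairing G.tensorPairing m (G.evaluation ∘ₗ θ.rTensor G.Dual) ↔ G.HasSlices θ m := by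
  rw [isExtendedPairing_iff]
  constructor
  · rintro ⟨hl, hr⟩
    refine ⟨fun b a a' => G.eq_of_toFunctional fun b' => ?_,
      fun b a a' => G.eq_of_toFunctional fun b' => ?_⟩
    · rw [← tensorPairing_tmul_right, ← hl]
      simp [evaluation_tmul, pair]
    · rw [← tensorPairing_tmul_right, ← hr]
      simp [evaluation_tmul, pair]
  · intro hm
    refine ⟨fun x y => ?_, fun x y => ?_⟩
    all_goals
      induction x with
      | tmul b a =>
        induction y with
        | tmul a' b' =>
          simp [tensorPairing_tmul_right, evaluation_tmul, pair, hm.evalFst_left,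
            hm.evalFst_right]
        | _ => simp_all
      | _ => simp_all

theorem exists_hasSlices {L R : G.Dual ⊗[ℂ] A →ₗ[ℂ] G.Dual ⊗[ℂ] A}
    (hL : ∀ b a a', G.evalFst a' (L (b ⊗ₜ a)) = θ (G.act b a') * a)
    (hR : ∀ b a a', G.evalFst a' (R (b ⊗ₜ a)) = a * θ (G.ract b a')) :
    ∃ m, G.HasSlices θ m := by
  refine ⟨⟨(L, MulOpposite.op R), fun x y => ?_, fun x y => ?_, fun x y => ?_⟩, hL, hR⟩
  all_goals
    induction x with
    | tmul b a =>
      induction y with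
      | tmul c d =>
        refine G.eq_of_evalFst fun a' => ?_
        simp [evalFst_mul_tmul, evalFst_tmul_mul, hL, hR, act_mul, ract_mul, ract_act, mul_assoc]
      | _ => simp_all [mul_add]
    | _ => simp_all [add_mul]

theorem HasSlices.embed_eq_inr_mul_inl (hm : G.HasSlices LinearMap.id m) {b : G.Dual} {a : A}
    {x : G.Dual ⊗[ℂ] A} (hx : ∀ a', G.evalFst a' x = a * G.act b a') :
    embed x = inr a * m * inl b := by
  refine MultiplierAlgebra.ext_tmul (fun c d => G.eq_of_evalFst fun a' => ?_)
    (fun c d => G.eq_of_evalFst fun a' => ?_)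
  · simp [left_mul_apply, left_inl, left_inr, evalFst_lTensor, hm.evalFst_left, evalFst_mul_tmul,
      hx, act_mul, mul_assoc]
  · simp [right_mul_apply, right_inl, right_inr, evalFst_rTensor_mulRight, hm.evalFst_right,
      evalFst_tmul_mul, hx, ract_act, mul_assoc]

theorem HasSlices.embed_eq_inl_mul_inr (hm : G.HasSlices LinearMap.id m) {b : G.Dual} {a : A}
    {x : G.Dual ⊗[ℂ] A} (hx : ∀ a', G.evalFst a' x = G.ract b a' * a) :
    embed x = inl b * m * inr a := by
  refine MultiplierAlgebra.ext_tmul (fun c d => G.eq_of_evalFst fun a' => ?_)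
    (fun c d => G.eq_of_evalFst fun a' => ?_)
  · simp [left_mul_apply, left_inl, left_inr, evalFst_rTensor_mulLeft, hm.evalFst_left,
      evalFst_mul_tmul, hx, ract_act, mul_assoc]
  · simp [right_mul_apply, right_inl, right_inr, evalFst_lTensor, hm.evalFst_right,
      evalFst_tmul_mul, hx, ract_mul, mul_assoc]

/-! ### The duality -/

variable (G)

theorem evalFst_map_leftDual (a' : A) (z : A ⊗[ℂ] A) :
    G.evalFst a' (TensorProduct.map G.leftDual G.S.toLinearMap (TensorProduct.comm ℂ A A z))
      = G.S (sliceRight G.φ ((LinearMap.mulRight ℂ a').lTensor A z)) := by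
  induction z <;> simp_all

theorem evalFst_map_rightDual (a' : A) (z : A ⊗[ℂ] A) :
    G.evalFst a' (TensorProduct.map G.rightDual G.S.toLinearMap z)
      = G.S (sliceLeft G.ψ ((LinearMap.mulLeft ℂ a').rTensor A z)) := by
  induction z <;> simp_all

theorem evalFst_map_leftDual_T₂ (a a' c : A) :
    G.evalFst a' (TensorProduct.map G.leftDual G.S.toLinearMap
      (TensorProduct.comm ℂ A A (G.T₂ (a ⊗ₜ c)))) = G.act (G.leftDual c) a' * G.S a := by
  rw [evalFst_map_leftDual, ← rTensor_mulLeft_T₁, sliceRight_rTensor, LinearMap.mulLeft_apply,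
    S_mul, S_sliceRight_T₁, act_leftDual]

theorem evalFst_map_leftDual_T₃ (a a' c : A) :
    G.evalFst a' (TensorProduct.map G.leftDual G.S.toLinearMap
      (TensorProduct.comm ℂ A A (G.T₃ (c ⊗ₜ a)))) = G.S a * G.act (G.leftDual c) a' := by
  rw [evalFst_map_leftDual, ← rTensor_mulRight_T₁, sliceRight_rTensor, LinearMap.mulRight_apply,
    S_mul, S_sliceRight_T₁, act_leftDual]

theorem evalFst_map_rightDual_T₁ (a a' c : A) :
    G.evalFst a' (TensorProduct.map G.rightDual G.S.toLinearMap (G.T₁ (c ⊗ₜ a)))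
      = G.S a * G.ract (G.rightDual c) a' := by
  rw [evalFst_map_rightDual, rTensor_mulLeft_T₁, sliceLeft_lTensor, LinearMap.mulRight_apply,
    S_mul, S_sliceLeft_T₂, ract_rightDual]

theorem evalFst_map_rightDual_T₄ (a a' c : A) :
    G.evalFst a' (TensorProduct.map G.rightDual G.S.toLinearMap (G.T₄ (a ⊗ₜ c)))
      = G.ract (G.rightDual c) a' * G.S a := by
  rw [evalFst_map_rightDual, ← lTensor_mulLeft_T₂, sliceLeft_lTensor, LinearMap.mulLeft_apply,
    S_mul, S_sliceLeft_T₂, ract_rightDual]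

variable {G} in
theorem exists_evalFst_tmul_eq {D : A →ₗ[ℂ] G.Dual} (hD : Function.Surjective D)
    (F : A ⊗[ℂ] A →ₗ[ℂ] G.Dual ⊗[ℂ] A) {k : G.Dual → A → A → A}
    (hF : ∀ c a a', G.evalFst a' (F (c ⊗ₜ a)) = k (D c) (G.S a) a') :
    ∃ L : G.Dual ⊗[ℂ] A →ₗ[ℂ] G.Dual ⊗[ℂ] A,
      ∀ b a a', G.evalFst a' (L (b ⊗ₜ a)) = k b a a' := by
  obtain ⟨s, hs⟩ := D.exists_rightInverse_of_surjective (LinearMap.range_eq_top.2 hD)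
  have D_s (b : G.Dual) : D (s b) = b := LinearMap.congr_fun hs b
  exact ⟨F ∘ₗ TensorProduct.map s G.S.symm.toLinearMap, fun b a a' => by simp [hF, D_s]⟩

theorem exists_evalFst_eq_act_mul : ∃ L : G.Dual ⊗[ℂ] A →ₗ[ℂ] G.Dual ⊗[ℂ] A,
    ∀ b a a', G.evalFst a' (L (b ⊗ₜ a)) = G.act b a' * a :=
  exists_evalFst_tmul_eq G.leftDual_surjective
    (TensorProduct.map G.leftDual G.S.toLinearMap ∘ₗ (TensorProduct.comm ℂ A A).toLinearMap ∘ₗ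
      G.T₂.toLinearMap ∘ₗ (TensorProduct.comm ℂ A A).toLinearMap)
    fun c a a' => G.evalFst_map_leftDual_T₂ a a' c

theorem exists_evalFst_eq_mul_act : ∃ L : G.Dual ⊗[ℂ] A →ₗ[ℂ] G.Dual ⊗[ℂ] A,
    ∀ b a a', G.evalFst a' (L (b ⊗ₜ a)) = a * G.act b a' :=
  exists_evalFst_tmul_eq G.leftDual_surjective
    (TensorProduct.map G.leftDual G.S.toLinearMap ∘ₗ (TensorProduct.comm ℂ A A).toLinearMap ∘ₗ
      G.T₃.toLinearMap)
    fun c a a' => G.evalFst_map_leftDual_T₃ a a' c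

theorem exists_evalFst_eq_mul_ract : ∃ R : G.Dual ⊗[ℂ] A →ₗ[ℂ] G.Dual ⊗[ℂ] A,
    ∀ b a a', G.evalFst a' (R (b ⊗ₜ a)) = a * G.ract b a' :=
  exists_evalFst_tmul_eq G.rightDual_surjective
    (TensorProduct.map G.rightDual G.S.toLinearMap ∘ₗ G.T₁.toLinearMap)
    fun c a a' => G.evalFst_map_rightDual_T₁ a a' c

theorem exists_evalFst_eq_ract_mul : ∃ R : G.Dual ⊗[ℂ] A →ₗ[ℂ] G.Dual ⊗[ℂ] A,
    ∀ b a a', G.evalFst a' (R (b ⊗ₜ a)) = G.ract b a' * a :=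
  exists_evalFst_tmul_eq G.rightDual_surjective
    (TensorProduct.map G.rightDual G.S.toLinearMap ∘ₗ G.T₄.toLinearMap ∘ₗ
      (TensorProduct.comm ℂ A A).toLinearMap)
    fun c a a' => G.evalFst_map_rightDual_T₄ a a' c

theorem exists_hasSlices_id : ∃ V, G.HasSlices LinearMap.id V := by
  obtain ⟨L, hL⟩ := G.exists_evalFst_eq_act_mul
  obtain ⟨R, hR⟩ := G.exists_evalFst_eq_mul_ract
  exact exists_hasSlices hL hR

theorem exists_hasSlices_S : ∃ W, G.HasSlices G.S.toLinearMap W := by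
  obtain ⟨X, hX⟩ := G.exists_evalFst_eq_mul_act
  obtain ⟨Y, hY⟩ := G.exists_evalFst_eq_ract_mul
  let conj (X : G.Dual ⊗[ℂ] A →ₗ[ℂ] G.Dual ⊗[ℂ] A) : G.Dual ⊗[ℂ] A →ₗ[ℂ] G.Dual ⊗[ℂ] A :=
    G.S.toLinearMap.lTensor G.Dual ∘ₗ X ∘ₗ G.S.symm.toLinearMap.lTensor G.Dual
  exact exists_hasSlices (L := conj X) (R := conj Y)
    (fun b a a' => by simp [conj, evalFst_lTensor, hX, S_mul])
    (fun b a a' => by simp [conj, evalFst_lTensor, hY, S_mul])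

theorem evaluation_comp_lTensor_dualS :
    G.evaluation ∘ₗ G.dualS.toLinearMap.lTensor A
      = G.evaluation ∘ₗ G.S.toLinearMap.rTensor G.Dual :=
  TensorProduct.ext' fun a b => G.toFunctional_dualS a b

theorem embed_dual_injective : Function.Injective
    (embed : G.Dual ⊗[ℂ] A → MultiplierAlgebra (G.Dual ⊗[ℂ] A)) :=
  embed_injective (G.nondegenerate_dual.tensor G.nondegenerate)

variable {G} {V W W' : MultiplierAlgebra (G.Dual ⊗[ℂ] A)}

theorem isDuality_iff_hasSlices : G.IsDuality V ↔ G.HasSlices LinearMap.id V := by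
  rw [← isExtendedPairing_evaluation_iff, LinearMap.rTensor_id, LinearMap.comp_id, IsDuality]

theorem HasSlices.leftFormula (hV : G.HasSlices LinearMap.id V) : G.LeftFormula V := by
  intro a c b hb
  obtain rfl : b = G.leftDual c := G.toFunctional_injective hb
  have left_tmul : left V (G.leftDual c ⊗ₜ a) = TensorProduct.map G.leftDual G.S.toLinearMap
      (TensorProduct.comm ℂ A A (G.T₂ (G.S.symm a ⊗ₜ c))) :=
    G.eq_of_evalFst fun a' => by simp [hV.evalFst_left, evalFst_map_leftDual_T₂]
  rw [left_tmul, ← LinearMap.comp_apply, LinearMap.rTensor_comp_map]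
  rfl

theorem HasSlices.rightFormula (hV : G.HasSlices LinearMap.id V) : G.RightFormula V := by
  intro a c b hb
  obtain rfl : b = G.rightDual c := G.toFunctional_injective hb
  have right_tmul : right V (G.rightDual c ⊗ₜ a) = TensorProduct.map G.rightDual G.S.toLinearMap
      (G.T₁ (c ⊗ₜ G.S.symm a)) :=
    G.eq_of_evalFst fun a' => by simp [hV.evalFst_right, evalFst_map_rightDual_T₁]
  rw [right_tmul, ← LinearMap.comp_apply, LinearMap.rTensor_comp_map]
  rfl

theorem HasSlices.isAntipodeSnd (hV : G.HasSlices LinearMap.id V)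
    (hW : G.HasSlices G.S.toLinearMap W) : G.IsAntipodeSnd V W := by
  obtain ⟨X, hX⟩ := G.exists_evalFst_eq_mul_act
  obtain ⟨Y, hY⟩ := G.exists_evalFst_eq_ract_mul
  refine fun a b =>
    ⟨⟨X (b ⊗ₜ a), hV.embed_eq_inr_mul_inl (hX b a), G.eq_of_evalFst fun a' => ?_⟩,
      ⟨Y (b ⊗ₜ a), hV.embed_eq_inl_mul_inr (hY b a), G.eq_of_evalFst fun a' => ?_⟩⟩
  · rw [hW.evalFst_left, evalFst_lTensor, hX, LinearEquiv.coe_coe, S_mul]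
  · rw [hW.evalFst_right, evalFst_lTensor, hY, LinearEquiv.coe_coe, S_mul]

theorem HasSlices.isAntipodeFst (hV : G.HasSlices LinearMap.id V)
    (hW : G.HasSlices G.S.toLinearMap W) : G.IsAntipodeFst V W := by
  obtain ⟨X, hX⟩ := G.exists_evalFst_eq_mul_act
  obtain ⟨Y, hY⟩ := G.exists_evalFst_eq_ract_mul
  refine fun a b =>
    ⟨⟨Y (b ⊗ₜ a), hV.embed_eq_inl_mul_inr (hY b a), G.eq_of_evalFst fun a' => ?_⟩,
      ⟨X (b ⊗ₜ a), hV.embed_eq_inr_mul_inl (hX b a), G.eq_of_evalFst fun a' => ?_⟩⟩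
  · rw [hW.evalFst_left, evalFst_rTensor_dualS, hY, LinearEquiv.coe_coe, S_act]
  · rw [hW.evalFst_right, evalFst_rTensor_dualS, hX, LinearEquiv.coe_coe, S_ract]

theorem IsAntipodeSnd.unique (hW : G.IsAntipodeSnd V W) (hW' : G.IsAntipodeSnd V W') :
    W = W' := by
  refine MultiplierAlgebra.ext_tmul (fun b => G.S.surjective.forall.2 fun a => ?_)
    (fun b => G.S.surjective.forall.2 fun a => ?_)
  · obtain ⟨⟨x, hx, h⟩, -⟩ := hW a b
    obtain ⟨⟨x', hx', h'⟩, -⟩ := hW' a b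
    rw [h, h', G.embed_dual_injective (hx.trans hx'.symm)]
  · obtain ⟨-, x, hx, h⟩ := hW a b
    obtain ⟨-, x', hx', h'⟩ := hW' a b
    rw [h, h', G.embed_dual_injective (hx.trans hx'.symm)]

theorem IsAntipodeFst.unique (hW : G.IsAntipodeFst V W) (hW' : G.IsAntipodeFst V W') :
    W = W' := by
  refine MultiplierAlgebra.ext_tmul (G.dualS.surjective.forall.2 fun b a => ?_)
    (G.dualS.surjective.forall.2 fun b a => ?_)
  · obtain ⟨⟨x, hx, h⟩, -⟩ := hW a b
    obtain ⟨⟨x', hx', h'⟩, -⟩ := hW' a b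
    rw [h, h', G.embed_dual_injective (hx.trans hx'.symm)]
  · obtain ⟨-, x, hx, h⟩ := hW a b
    obtain ⟨-, x', hx', h'⟩ := hW' a b
    rw [h, h', G.embed_dual_injective (hx.trans hx'.symm)]

end AlgebraicQuantumGroup

end

theorem proposition3p8 {A : Type*} [NonUnitalRing A] [Module ℂ A] [IsScalarTower ℂ A A]
    [SMulCommClass ℂ A A] (G : AlgebraicQuantumGroup A) :
    -- the objects entering the statement are the ones they are meant to be
    (G.IsAntipode G.S ∧ G.IsRightIntegral G.ψ ∧ G.IsDualAntipode G.dualS ∧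
      LinearMap.range (AlgebraicQuantumGroup.mulLeftFunctional G.φ) = G.dualSubmodule ∧
      LinearMap.range (AlgebraicQuantumGroup.mulRightFunctional G.ψ) = G.dualSubmodule) ∧
    -- existence and uniqueness of the duality, and its explicit form
    (∃! V : MultiplierAlgebra (G.Dual ⊗[ℂ] A), G.IsDuality V) ∧
    ∀ V : MultiplierAlgebra (G.Dual ⊗[ℂ] A), G.IsDuality V →
      G.LeftFormula V ∧ G.RightFormula V ∧
      (∃! W : MultiplierAlgebra (G.Dual ⊗[ℂ] A), G.IsAntipodeSnd V W) ∧
      (∃! W : MultiplierAlgebra (G.Dual ⊗[ℂ] A), G.IsAntipodeFst V W) ∧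
      (∀ W : MultiplierAlgebra (G.Dual ⊗[ℂ] A), G.IsAntipodeSnd V W →
        IsExtendedPairing G.tensorPairing W
          (G.evaluation ∘ₗ G.dualS.toLinearMap.lTensor A)) ∧
      (∀ W : MultiplierAlgebra (G.Dual ⊗[ℂ] A), G.IsAntipodeFst V W →
        IsExtendedPairing G.tensorPairing W
          (G.evaluation ∘ₗ G.S.toLinearMap.rTensor G.Dual)) := by
  refine ⟨⟨G.isAntipode_S, G.isRightIntegral_ψ, G.isDualAntipode_dualS,
    G.range_mulLeftFunctional_φ, G.range_mulRightFunctional_ψ⟩, ?_, fun V hV => ?_⟩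
  · obtain ⟨V, hV⟩ := G.exists_hasSlices_id
    exact ⟨V, AlgebraicQuantumGroup.isDuality_iff_hasSlices.2 hV, fun V' hV' =>
      (AlgebraicQuantumGroup.isDuality_iff_hasSlices.1 hV').unique hV⟩
  · replace hV := AlgebraicQuantumGroup.isDuality_iff_hasSlices.1 hV
    obtain ⟨W, hW⟩ := G.exists_hasSlices_S
    have snd := hV.isAntipodeSnd hW
    have fst := hV.isAntipodeFst hW
    have pairing := AlgebraicQuantumGroup.isExtendedPairing_evaluation_iff.2 hW
    refine ⟨hV.leftFormula, hV.rightFormula, ⟨W, snd, fun W' h => h.unique snd⟩,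
      ⟨W, fst, fun W' h => h.unique fst⟩, fun W' h => ?_, fun W' h => ?_⟩
    · rwa [h.unique snd, G.evaluation_comp_lTensor_dualS]
    · rwa [h.unique fst]
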